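/- Let $M=\mathbb H^3/\Gamma$ be a complete hyperbolic 3-manifold ($\Gamma$ acts freely and properly discontinuously by isometries on the upper half-space $\mathbb H^3=\{(x,y,z): z>0\}$) with covering map $\rho:\mathbb H^3\to M$. Let $N\subset M$ be a toroidal cusp: $N=\rho(B)$ for a horoball $B$ (the image of $\{z\ge 1\}$ under an isometry of $\mathbb H^3$) whose translates under $\Gamma$ have pairwise disjoint interiors, and the quotient $T=\partial N$ of the horosphere $\partial B$ by the stabilizer of $B$ in $\Gamma$ is a torus, mapped to $M$ by $\rho$. Let $S$ be a closed, connected, possibly nonorientable hyperbolic surface of genus $g$, where $g$ is normalized by $\chi(S)=2-2g$ (so $g$ is the usual genus if $S$ is orientable, and half the number of crosscaps if not), and let $F=(S,\varphi)$ be a pleated surface in $M$. That is, $\varphi:S\to M$ is continuous; it maps every geodesic segment of $S$ to an arc of the same length that is geodesic on the closure of each component of the complement of some closed nowhere dense subset of the arc; and every point of $S$ lies on an open geodesic segment that $\varphi$ maps to a geodesic segment of $M$. Suppose that $F$ is incompressible, i.e. $\varphi_*:\pi_1(S)\to\pi_1(M)$ is injective, and that $F$ is not coannular to $T$, i.e.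 there is no $\pi_1$-injective map of an annulus $S^1\times[0,1]\to M$ whose restriction to $S^1\times\{0\}$ is a loop on $F$ (the composition of $\varphi$ with a loop in $S$) and whose restriction to $S^1\times\{1\}$ is a loop on $T$. (An essential surface is in particular incompressible.) Let the depth $d_N(F)$ be the maximal distance in $M$ from points of $F\cap N$ to $T$, and $0$ if $F\cap N=\emptyset$. Then $$d_N(F)<\ln(2g\pi).$$ -/

import Mathlib

noncomputable section

open scoped UpperHalfPlane Pointwise ENNReal

/-! ### Hyperbolic three-space: the upper half-space model -/

/-- Points `(x, y, z)` of `ℝ³` with `z > 0`. -/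
@[ext]
structure HypSpace where
  x : ℝ
  y : ℝ
  z : ℝ
  z_pos : 0 < z

namespace HypSpace

/-- The underlying point of Euclidean three-space. -/
def toE (p : HypSpace) : EuclideanSpace ℝ (Fin 3) := !₂[p.x, p.y, p.z]

/-- The mirror image of a point in the plane `z = 0` (used for the triangle inequality). -/
def mirror (p : HypSpace) : EuclideanSpace ℝ (Fin 3) := !₂[p.x, p.y, -p.z]

theorem dist_toE (p q : HypSpace) :
    dist p.toE q.toE = √((p.x - q.x) ^ 2 + (p.y - q.y) ^ 2 + (p.z - q.z) ^ 2) := by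
  simp [toE, EuclideanSpace.dist_eq, Fin.sum_univ_three, Real.dist_eq, sq_abs]

theorem dist_toE_mirror (p q : HypSpace) :
    dist p.toE q.mirror = √((p.x - q.x) ^ 2 + (p.y - q.y) ^ 2 + (p.z + q.z) ^ 2) := by
  simp [toE, mirror, EuclideanSpace.dist_eq, Fin.sum_univ_three, Real.dist_eq, sq_abs]

/-- The distance of the Riemannian metric `(dx² + dy² + dz²) / z²`, by the same closed formula as
for Mathlib's upper half-plane: `sinh (d / 2) = |p - q| / (2 √(z_p z_q))`. -/
instance : Dist HypSpace :=
  ⟨fun p q => 2 * Real.arsinh (dist p.toE q.toE / (2 * √(p.z * q.z)))⟩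

theorem dist_eq (p q : HypSpace) :
    dist p q = 2 * Real.arsinh (dist p.toE q.toE / (2 * √(p.z * q.z))) := rfl

theorem sinh_half_dist (p q : HypSpace) :
    Real.sinh (dist p q / 2) = dist p.toE q.toE / (2 * √(p.z * q.z)) := by
  rw [dist_eq, mul_div_cancel_left₀ _ (two_ne_zero' ℝ), Real.sinh_arsinh]

theorem cosh_half_dist (p q : HypSpace) :
    Real.cosh (dist p q / 2) = dist p.toE q.mirror / (2 * √(p.z * q.z)) := by
  have hp := p.z_pos
  have hq := q.z_pos
  rw [← sq_eq_sq₀ (by positivity) (by positivity), Real.cosh_sq', sinh_half_dist, div_pow, div_pow,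
    mul_pow, Real.sq_sqrt (by positivity), dist_toE, dist_toE_mirror, Real.sq_sqrt (by positivity),
    Real.sq_sqrt (by positivity)]
  field_simp
  ring

theorem dist_triangle' (a b c : HypSpace) : dist a c ≤ dist a b + dist b c := by
  have ha := a.z_pos
  have hb := b.z_pos
  have hc := c.z_pos
  have key := EuclideanGeometry.mul_dist_le_mul_dist_add_mul_dist a.toE b.toE c.toE b.mirror
  have hbb : dist b.toE b.mirror = 2 * b.z := by
    rw [dist_toE_mirror, Real.sqrt_eq_iff_mul_self_eq (by positivity) (by positivity)]
    ring
  have hcomm : dist b.toE c.mirror = dist c.toE b.mirror := by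
    rw [dist_toE_mirror, dist_toE_mirror]
    congr 1
    ring
  suffices h : Real.sinh (dist a c / 2) ≤ Real.sinh (dist a b / 2 + dist b c / 2) by
    have := Real.sinh_le_sinh.1 h
    linarith
  rw [Real.sinh_add, sinh_half_dist, sinh_half_dist, sinh_half_dist, cosh_half_dist,
    cosh_half_dist, hcomm, Real.sqrt_mul ha.le, Real.sqrt_mul ha.le, Real.sqrt_mul hb.le]
  rw [hbb] at key
  have sa := Real.sqrt_pos.2 ha
  have sb := Real.sqrt_pos.2 hb
  have sc := Real.sqrt_pos.2 hc
  have hz : b.z = √b.z * √b.z := (Real.mul_self_sqrt hb.le).symm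
  have e : dist a.toE b.toE / (2 * (√a.z * √b.z)) * (dist c.toE b.mirror / (2 * (√b.z * √c.z))) +
      dist a.toE b.mirror / (2 * (√a.z * √b.z)) * (dist b.toE c.toE / (2 * (√b.z * √c.z))) =
      (dist a.toE b.toE * dist c.toE b.mirror + dist b.toE c.toE * dist a.toE b.mirror) /
        (2 * (√a.z * √c.z) * (2 * b.z)) := by
    rw [hz]
    simp only [Real.sqrt_mul_self sb.le]
    field_simp
  rw [e, div_le_div_iff₀ (by positivity) (by positivity)]
  have h := mul_le_mul_of_nonneg_right key (by positivity : 0 ≤ 2 * (√a.z * √c.z))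
  linarith

instance : MetricSpace HypSpace where
  dist_self p := by simp [dist_eq]
  dist_comm p q := by rw [dist_eq, dist_eq, dist_comm, mul_comm p.z]
  dist_triangle := dist_triangle'
  eq_of_dist_eq_zero {p q} h := by
    have hp := p.z_pos
    have hq := q.z_pos
    have h2 : √(p.z * q.z) ≠ 0 := (Real.sqrt_pos.2 (mul_pos hp hq)).ne'
    have h1 : dist p.toE q.toE = 0 := by simpa [dist_eq, h2] using h
    have h3 : p.toE = q.toE := dist_eq_zero.1 h1
    ext
    · simpa [toE] using congrFun (congrArg WithLp.ofLp h3) 0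
    · simpa [toE] using congrFun (congrArg WithLp.ofLp h3) 1
    · simpa [toE] using congrFun (congrArg WithLp.ofLp h3) 2

end HypSpace

/-! ### Complete hyperbolic manifolds

A complete hyperbolic surface (3-manifold) is the quotient of the hyperbolic plane `ℍ` (of the
hyperbolic space `HypSpace`) by a group acting freely and properly discontinuously by isometries;
orientation-reversing isometries are allowed. -/

/-- The orbit space `X / G`, with the quotient topology. -/
abbrev OrbitSpace (G X : Type*) [Group G] [MulAction G X] : Type _ :=
  Quotient (MulAction.orbitRel G X)

/-- The covering projection `X → X / G`. -/
def OrbitSpace.proj (G : Type*) {X : Type*} [Group G] [MulAction G X] (x : X) : OrbitSpace G X :=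
  Quotient.mk (MulAction.orbitRel G X) x

/-- The distance of the quotient metric: the least distance between points above `p` and `q`. -/
def OrbitSpace.qdist {G X : Type*} [Group G] [MulAction G X] [PseudoEMetricSpace X]
    (p q : OrbitSpace G X) : ℝ≥0∞ :=
  ⨅ (x : X) (_ : OrbitSpace.proj G x = p) (y : X) (_ : OrbitSpace.proj G y = q), edist x y

/-! ### Closed surfaces and their genus -/

/-- The point with parameter `t ∈ [0, 1]` on the `j`-th of `m` consecutive equal arcs ("edges"),
traversed counterclockwise, of the unit circle. -/
def polygonEdge (m j : ℕ) (t : ℝ) : ℂ :=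
  Complex.exp (2 * Real.pi * Complex.I * ((j + t) / m))

/-- The edges of a `4n`-gon are glued by the word `∏ aᵢ bᵢ aᵢ⁻¹ bᵢ⁻¹`. -/
def orientableGluing (n : ℕ) (p q : Metric.closedBall (0 : ℂ) 1) : Prop :=
  ∃ i < n, ∃ t ∈ Set.Icc (0 : ℝ) 1,
    ((p : ℂ) = polygonEdge (4 * n) (4 * i) t ∧
      (q : ℂ) = polygonEdge (4 * n) (4 * i + 2) (1 - t)) ∨
    ((p : ℂ) = polygonEdge (4 * n) (4 * i + 1) t ∧
      (q : ℂ) = polygonEdge (4 * n) (4 * i + 3) (1 - t))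

/-- The edges of a `2k`-gon are glued by the word `∏ aᵢ aᵢ`. -/
def nonorientableGluing (k : ℕ) (p q : Metric.closedBall (0 : ℂ) 1) : Prop :=
  ∃ i < k, ∃ t ∈ Set.Icc (0 : ℝ) 1,
    (p : ℂ) = polygonEdge (2 * k) (2 * i) t ∧ (q : ℂ) = polygonEdge (2 * k) (2 * i + 1) t

/-- The connected sum of `n ≥ 1` tori. -/
abbrev OrientableSurface (n : ℕ) : Type := Quot (orientableGluing n)

/-- The connected sum of `k ≥ 1` projective planes. -/
abbrev NonorientableSurface (k : ℕ) : Type := Quot (nonorientableGluing k)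

/-- `S` is a closed connected surface, other than the sphere, of genus `g`, where the genus is
normalized by `χ(S) = 2 - 2 g`: it is `n` for the connected sum of `n` tori and `k / 2` for the
connected sum of `k` projective planes. -/
def IsClosedSurfaceOfGenus (S : Type*) [TopologicalSpace S] (g : ℝ) : Prop :=
  (∃ n : ℕ, 0 < n ∧ Nonempty (S ≃ₜ OrientableSurface n) ∧ g = n) ∨
  (∃ k : ℕ, 0 < k ∧ Nonempty (S ≃ₜ NonorientableSurface k) ∧ g = k / 2)

/-! ### Incompressibility -/

/-- `φ` is injective on fundamental groups. -/
def IsIncompressible {X Y : Type*} [TopologicalSpace X] [TopologicalSpace Y] (φ : C(X, Y)) :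
    Prop :=
  ∀ x : X, Function.Injective (FundamentalGroup.map φ x)

/-! ### Pleated surfaces -/

/-- On the interval `I`, the curve `c` is a geodesic of `X` parametrized by arc length. In the
hyperbolic plane and in hyperbolic space geodesics are distance-minimizing, so that this is an
isometric embedding of `I`. Geodesics of a hyperbolic manifold are the projections of these. -/
def IsGeodesicOn {X : Type*} [MetricSpace X] (c : ℝ → X) (I : Set ℝ) : Prop :=
  ∀ s ∈ I, ∀ t ∈ I, dist (c s) (c t) = |s - t|

/-- The arc `c : [0, l] → X` has a closed nowhere dense set of parameters such that it is a
geodesic on (the closure of) each component of the complement of this set. -/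
def IsRectifiableArc {X : Type*} [MetricSpace X] (c : ℝ → X) (l : ℝ) : Prop :=
  ContinuousOn c (Set.Icc 0 l) ∧
  ∃ E ⊆ Set.Icc (0 : ℝ) l, IsClosed E ∧ IsNowhereDense E ∧
    ∀ J ⊆ Set.Icc (0 : ℝ) l \ E, IsPreconnected J → IsGeodesicOn c (closure J)

/-- `(ℍ / Δ, φ)` is a pleated surface in the hyperbolic manifold `HypSpace / Γ`:
* each geodesic segment of the surface (the projection of a geodesic segment `c : [0, l] → ℍ`)
  is mapped to a rectifiable arc of the same length;
* each point of the surface lies on an open geodesic segment which is mapped to a geodesic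
  segment.

Since the projection `HypSpace → HypSpace / Γ` is a covering and a local isometry, length,
rectifiability and being a geodesic are read off from a lift `c'` of the arc to `HypSpace`. -/
structure IsPleatedSurface {Δ Γ : Type*} [Group Δ] [MulAction Δ ℍ] [Group Γ] [MulAction Γ HypSpace]
    (φ : C(OrbitSpace Δ ℍ, OrbitSpace Γ HypSpace)) : Prop where
  isometric : ∀ (l : ℝ) (c : ℝ → ℍ), 0 ≤ l → IsGeodesicOn c (Set.Icc 0 l) →
    ∃ c' : ℝ → HypSpace,
      (∀ t ∈ Set.Icc 0 l, OrbitSpace.proj Γ (c' t) = φ (OrbitSpace.proj Δ (c t))) ∧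
      IsRectifiableArc c' l ∧ eVariationOn c' (Set.Icc 0 l) = ENNReal.ofReal l
  exists_geodesic : ∀ x : OrbitSpace Δ ℍ, ∃ ε > 0, ∃ (c : ℝ → ℍ) (c' : ℝ → HypSpace),
    OrbitSpace.proj Δ (c 0) = x ∧ IsGeodesicOn c (Set.Ioo (-ε) ε) ∧
    (∀ t ∈ Set.Ioo (-ε) ε, OrbitSpace.proj Γ (c' t) = φ (OrbitSpace.proj Δ (c t))) ∧
    IsGeodesicOn c' (Set.Ioo (-ε) ε)

/-! ### Toroidal cusps -/

/-- Two points of a horosphere `H = ∂B` are identified if an element of `Γ` which preserves the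
horoball `B` takes one to the other. -/
def horosphereRel (Γ : Type*) [Group Γ] [MulAction Γ HypSpace] (B H : Set HypSpace) (p q : H) :
    Prop :=
  ∃ γ : Γ, γ • B = B ∧ γ • (p : HypSpace) = q

/-- A toroidal cusp of `HypSpace / Γ`. It is given by a horoball `chart '' {z ≥ 1}` covering it,
where `chart` is an isometry of hyperbolic space. The translates of this horoball under `Γ` have
disjoint interiors, and the quotient of the bounding horosphere by the stabilizer of the horoball
is a torus. -/
structure ToroidalCusp (Γ : Type*) [Group Γ] [MulAction Γ HypSpace] where
  chart : HypSpace ≃ᵢ HypSpace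
  precisely_invariant : ∀ γ : Γ,
    γ • (chart '' {p | 1 ≤ p.z}) = chart '' {p | 1 ≤ p.z} ∨
    Disjoint (γ • (chart '' {p | 1 < p.z})) (chart '' {p | 1 < p.z})
  toroidal : Nonempty
    (Quot (horosphereRel Γ (chart '' {p | 1 ≤ p.z}) (chart '' {p | p.z = 1})) ≃ₜ Circle × Circle)

namespace ToroidalCusp

variable {Γ : Type*} [Group Γ] [MulAction Γ HypSpace]

/-- The horoball covering the cusp. -/
def horoball (N : ToroidalCusp Γ) : Set HypSpace := N.chart '' {p | 1 ≤ p.z}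

/-- The horosphere bounding the horoball. -/
def horosphere (N : ToroidalCusp Γ) : Set HypSpace := N.chart '' {p | p.z = 1}

/-- The cusp, as a subset of the manifold. -/
def carrier (N : ToroidalCusp Γ) : Set (OrbitSpace Γ HypSpace) :=
  OrbitSpace.proj Γ '' N.horoball

/-- The boundary torus of the cusp, as an abstract surface. -/
abbrev Torus (N : ToroidalCusp Γ) : Type := Quot (horosphereRel Γ N.horoball N.horosphere)

/-- The boundary torus as a surface in the manifold. This is an embedding unless two of the
horoballs covering the cusp touch; then the torus touches itself. -/
def torusMap (N : ToroidalCusp Γ) : N.Torus → OrbitSpace Γ HypSpace :=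
  Quot.lift (fun p => OrbitSpace.proj Γ (p : HypSpace)) (by
    rintro p q ⟨γ, -, h⟩
    exact (Quotient.sound (s := MulAction.orbitRel Γ HypSpace) ⟨γ, h⟩).symm)

/-- The depth of a surface `(S, φ)` in the cusp `N`: the supremum of the distances to the boundary
torus from the points of the surface in `N`, and zero if there are none. -/
def depth {S : Type*} (N : ToroidalCusp Γ) (φ : S → OrbitSpace Γ HypSpace) : ℝ≥0∞ :=
  ⨆ (s : S) (_ : φ s ∈ N.carrier), ⨅ t : N.Torus, OrbitSpace.qdist (φ s) (N.torusMap t)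

/-- The surface `(S, φ)` is coannular to the boundary torus of `N`: there is an incompressible
annulus `A` with one boundary component a loop on the surface and the other one a loop on the
torus. -/
def Coannular {S : Type*} [TopologicalSpace S] (N : ToroidalCusp Γ)
    (φ : C(S, OrbitSpace Γ HypSpace)) : Prop :=
  ∃ (A : C(Circle × unitInterval, OrbitSpace Γ HypSpace)) (a : C(Circle, S)) (b : C(Circle, N.Torus)),
    IsIncompressible A ∧ (∀ u, A (u, 0) = φ (a u)) ∧ (∀ u, A (u, 1) = N.torusMap (b u))

end ToroidalCusp

end

/-!
Lift the surface to a map `Φ : ℍ → HypSpace`, which does not increase distances because geodesic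
segments are mapped to arcs of the same length. Suppose that `Φ x` lies at depth `d` in the horoball
covering the cusp. Then `Φ` maps the disk `D` of radius `d` about `x` into the interior of the
horoball. If a nontrivial deck transformation moved `D` to a disk meeting `D`, then some `γ ≠ 1` in
`Γ` would preserve the horoball. It would be of infinite order, since an isometry of finite order of
the horosphere, a Euclidean plane, has a fixed point, and the strip between a path in `ℍ` and the
horosphere would cover an annulus showing that the surface is coannular to the torus. So `D` embeds
in the surface and has area `2π (cosh d - 1)`.

On the other hand, the surface is an `m`-gon with edges identified, `m = 4g`. Straightening the
polygon is an equivariant map of `ℍ` at bounded distance from the identity and hence surjective, so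
the surface is covered by `m - 2` geodesic triangles and its area is at most `(m - 2) π`. It follows
that `cosh d ≤ m / 2 = 2g`, whence `exp d < 4g < 2gπ`.
-/

noncomputable section

open scoped UpperHalfPlane Pointwise ENNReal

open MeasureTheory

/-! ### Isometries of the hyperbolic plane -/

namespace HyperbolicPlane

open UpperHalfPlane

section Isometries

open scoped MatrixGroups

/-- The rotation of the hyperbolic plane about `I` through the angle `2 θ`. -/
def rotation (θ : ℝ) : SL(2, ℝ) :=
  ⟨!![Real.cos θ, Real.sin θ; -Real.sin θ, Real.cos θ], by
    rw [Matrix.det_fin_two_of, ← Real.cos_sq_add_sin_sq θ]; ring⟩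

theorem rotation_denom_ne_zero (θ : ℝ) (z : ℍ) : -(Real.sin θ : ℂ) * z + Real.cos θ ≠ 0 := by
  simpa using linear_ne_zero (cd := ![-Real.sin θ, Real.cos θ]) z fun h => by
    have h0 : Real.sin θ = 0 := by simpa using congrFun h 0
    have h1 : Real.cos θ = 0 := by simpa using congrFun h 1
    simpa [h0, h1] using Real.cos_sq_add_sin_sq θ

theorem coe_rotation_smul (θ : ℝ) (z : ℍ) : (↑(rotation θ • z) : ℂ) =
    (Real.cos θ * z + Real.sin θ) / (-Real.sin θ * z + Real.cos θ) := by
  rw [coe_specialLinearGroup_apply]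
  simp [rotation]

theorem rotation_smul_I (θ : ℝ) : rotation θ • I = I := by
  apply UpperHalfPlane.ext
  rw [coe_rotation_smul, div_eq_iff (rotation_denom_ne_zero θ I), coe_I]
  linear_combination (Real.sin θ : ℂ) * Complex.I_mul_I

theorem rotation_zero_smul (z : ℍ) : rotation 0 • z = z := by
  apply UpperHalfPlane.ext
  simp [coe_rotation_smul]

theorem coe_rotation_pi_div_two_smul (z : ℍ) :
    (↑(rotation (Real.pi / 2) • z) : ℂ) = -(z : ℂ)⁻¹ := by
  rw [coe_rotation_smul, Real.cos_pi_div_two, Real.sin_pi_div_two]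
  simp [div_eq_mul_inv, inv_neg]

theorem re_rotation_pi_div_two_smul (z : ℍ) :
    (rotation (Real.pi / 2) • z).re = -z.re / Complex.normSq z := by
  rw [← coe_re, coe_rotation_pi_div_two_smul, Complex.neg_re, Complex.inv_re, coe_re, neg_div]

theorem im_rotation_pi_div_two_smul (z : ℍ) :
    (rotation (Real.pi / 2) • z).im = z.im / Complex.normSq z := by
  rw [← coe_im, coe_rotation_pi_div_two_smul, Complex.neg_im, Complex.inv_im, coe_im, neg_div,
    neg_neg]

theorem continuous_rotation_smul (z : ℍ) : Continuous fun θ => rotation θ • z := by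
  rw [isEmbedding_coe.continuous_iff]
  have coe_eq : (UpperHalfPlane.coe ∘ fun θ => rotation θ • z) = fun θ : ℝ =>
      ((Real.cos θ * z + Real.sin θ) / (-Real.sin θ * z + Real.cos θ) : ℂ) :=
    funext fun θ => coe_rotation_smul θ z
  rw [coe_eq]
  exact .div (by fun_prop) (by fun_prop) fun θ => rotation_denom_ne_zero θ z

theorem exists_re_rotation_smul_eq_zero (z : ℍ) : ∃ θ, (rotation θ • z).re = 0 := by
  have hc : Continuous fun θ => (rotation θ • z).re :=
    continuous_re.comp (continuous_rotation_smul z)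
  have hn : 0 ≤ Complex.normSq z := Complex.normSq_nonneg _
  rcases le_total z.re 0 with h | h
  · refine mem_range_of_exists_le_of_exists_ge hc ⟨0, ?_⟩ ⟨Real.pi / 2, ?_⟩
    · rwa [rotation_zero_smul]
    · rw [re_rotation_pi_div_two_smul]
      exact div_nonneg (neg_nonneg.2 h) hn
  · refine mem_range_of_exists_le_of_exists_ge hc ⟨Real.pi / 2, ?_⟩ ⟨0, ?_⟩
    · rw [re_rotation_pi_div_two_smul]
      exact div_nonpos_of_nonpos_of_nonneg (neg_nonpos.2 h) hn
    · rwa [rotation_zero_smul]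

theorem exists_smul_I_eq_I_of_re_eq_zero {w : ℍ} (hw : w.re = 0) :
    ∃ g : SL(2, ℝ), g • I = I ∧ (g • w).re = 0 ∧ 1 ≤ (g • w).im := by
  rcases le_total 1 w.im with h | h
  · exact ⟨1, one_smul _ _, by rwa [one_smul], by rwa [one_smul]⟩
  · refine ⟨rotation (Real.pi / 2), rotation_smul_I _, ?_, ?_⟩
    · rw [re_rotation_pi_div_two_smul, hw, neg_zero, zero_div]
    · have hpos := w.im_pos
      rw [im_rotation_pi_div_two_smul, Complex.normSq_apply, coe_re, coe_im, hw, zero_mul, zero_add,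
        le_div_iff₀ (mul_pos hpos hpos), one_mul]
      exact mul_le_of_le_one_left hpos.le h

theorem exists_smul_eq_I_and_re_smul_eq_zero (b c : ℍ) :
    ∃ g : SL(2, ℝ), g • b = I ∧ (g • c).re = 0 ∧ 1 ≤ (g • c).im := by
  obtain ⟨g₁, hb⟩ := MulAction.exists_smul_eq SL(2, ℝ) b I
  obtain ⟨θ, hθ⟩ := exists_re_rotation_smul_eq_zero (g₁ • c)
  obtain ⟨g₂, hI, hre, him⟩ := exists_smul_I_eq_I_of_re_eq_zero hθ
  refine ⟨g₂ * (rotation θ * g₁), ?_, ?_, ?_⟩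
  · rw [mul_smul, mul_smul, hb, rotation_smul_I, hI]
  · rwa [mul_smul, mul_smul]
  · rwa [mul_smul, mul_smul]

theorem eq_of_dist_I_eq_of_re_eq_zero {z w : ℍ} (hz : z.re = 0) (hw : w.re = 0) (hz1 : 1 ≤ z.im)
    (hw1 : 1 ≤ w.im) (h : dist z I = dist w I) : z = w := by
  have dist_I {u : ℍ} (hu : u.re = 0) (hu1 : 1 ≤ u.im) : dist u I = Real.log u.im := by
    rw [dist_of_re_eq (hu.trans I_re.symm), I_im, Real.log_one, dist_zero_right,
      Real.norm_of_nonneg (Real.log_nonneg hu1)]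
  rw [dist_I hz hz1, dist_I hw hw1] at h
  exact UpperHalfPlane.ext (Complex.ext (hz.trans hw.symm)
    (Real.log_injOn_pos (Set.mem_Ioi.2 z.im_pos) (Set.mem_Ioi.2 w.im_pos) h))

theorem im_eq_and_sq_re_eq_of_dist_eq {z w p : ℍ} (hp : p.re = 0) (hp1 : p.im ≠ 1)
    (hI : dist z I = dist w I) (hzp : dist z p = dist w p) :
    z.im = w.im ∧ z.re ^ 2 = w.re ^ 2 := by
  have hpos := p.im_pos
  have eI := congrArg Real.cosh hI
  have ep := congrArg Real.cosh hzp
  rw [cosh_dist', cosh_dist', div_eq_div_iff (by positivity) (by positivity)] at eI ep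
  simp only [I_re, I_im, hp, sub_zero] at eI ep
  have sq_ne : p.im ^ 2 - 1 ≠ 0 := by
    rwa [sub_ne_zero, ne_eq, pow_eq_one_iff_of_nonneg hpos.le two_ne_zero]
  have him : w.im = z.im := by
    refine mul_left_cancel₀ (mul_ne_zero hpos.ne' sq_ne) ?_
    linear_combination (1 / 2) * ep - (p.im / 2) * eI
  refine ⟨him.symm, mul_left_cancel₀ z.im_ne_zero ?_⟩
  rw [him] at eI
  linear_combination eI / 2

theorem im_eq_and_sq_re_eq_of_isometry {f : ℍ → ℍ} (hf : Isometry f) (hI : f I = I) {p : ℍ}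
    (hp : p.re = 0) (hp1 : p.im ≠ 1) (hfp : f p = p) (z : ℍ) :
    (f z).im = z.im ∧ (f z).re ^ 2 = z.re ^ 2 := by
  refine im_eq_and_sq_re_eq_of_dist_eq hp hp1 ?_ ?_
  · simpa only [hI] using hf.dist_eq z I
  · simpa only [hfp] using hf.dist_eq z p

theorem eq_self_of_isometry {f : ℍ → ℍ} (hf : Isometry f) (hI : f I = I) {p : ℍ}
    (hp : p.re = 0) (hp1 : p.im ≠ 1) (hfp : f p = p) {q : ℍ} (hq : q.re ≠ 0) (hfq : f q = q)
    (z : ℍ) : f z = z := by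
  obtain ⟨him, hsq⟩ := im_eq_and_sq_re_eq_of_isometry hf hI hp hp1 hfp z
  have e := congrArg Real.cosh (hf.dist_eq z q)
  rw [hfq, cosh_dist', cosh_dist', him, div_left_inj' (by positivity)] at e
  have hre : (f z).re = z.re := mul_left_cancel₀ hq (by linear_combination (hsq - e) / 2)
  exact UpperHalfPlane.ext (Complex.ext hre him)

theorem re_J_smul (z : ℍ) : (J • z).re = -z.re := by rw [← coe_re, coe_J_smul]; simp

theorem im_J_smul (z : ℍ) : (J • z).im = z.im := by rw [← coe_im, coe_J_smul]; simp

theorem J_smul_eq_self {z : ℍ} (hz : z.re = 0) : J • z = z :=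
  UpperHalfPlane.ext (Complex.ext (by simp [re_J_smul, hz]) (im_J_smul z))

theorem isometry_J_smul : Isometry fun z : ℍ => J • z := by
  refine Isometry.of_dist_eq fun z w =>
    Real.cosh_injOn dist_nonneg dist_nonneg ?_
  rw [cosh_dist', cosh_dist', re_J_smul, re_J_smul, im_J_smul, im_J_smul]
  ring

theorem exists_eq_smul_of_isometry {f : ℍ → ℍ} (hf : Isometry f) :
    ∃ g : GL (Fin 2) ℝ, ∀ z, f z = g • z := by
  let p : ℍ := ⟨⟨0, 2⟩, two_pos⟩
  let q : ℍ := ⟨⟨1, 1⟩, one_pos⟩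
  have hp : p.re = 0 := rfl
  have hp1 : p.im ≠ 1 := OfNat.ofNat_ne_one 2
  have hq : q.re ≠ 0 := one_ne_zero
  obtain ⟨g, hI, hgp, hgp1⟩ := exists_smul_eq_I_and_re_smul_eq_zero (f I) (f p)
  have hgf : Isometry fun z : ℍ => g • f z := (isometry_smul ℍ g).comp hf
  have hfp : g • f p = p := eq_of_dist_I_eq_of_re_eq_zero hgp hp hgp1 one_le_two <| by
    simpa only [hI] using hgf.dist_eq p I
  obtain ⟨him, hsq⟩ := im_eq_and_sq_re_eq_of_isometry hgf hI hp hp1 hfp q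
  rcases sq_eq_sq_iff_eq_or_eq_neg.1 hsq with hre | hre
  · have hfq : g • f q = q := UpperHalfPlane.ext (Complex.ext hre him)
    exact ⟨(g : GL (Fin 2) ℝ)⁻¹, fun z =>
      eq_inv_smul_iff.2 (eq_self_of_isometry hgf hI hp hp1 hfp hq hfq z)⟩
  · have hfq : J • g • f q = q := UpperHalfPlane.ext
      (Complex.ext (by simp [re_J_smul, hre]) (by simp [im_J_smul, him]))
    refine ⟨(J * (g : GL (Fin 2) ℝ))⁻¹, fun z => ?_⟩
    rw [eq_inv_smul_iff, mul_smul]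
    exact eq_self_of_isometry (isometry_J_smul.comp hgf) (by simp [hI, J_smul_eq_self])
      hp hp1 (by simp [hfp, J_smul_eq_self hp]) hq hfq z

theorem volume_preimage_of_isometry {f : ℍ → ℍ} (hf : Isometry f) (s : Set ℍ) :
    volume (f ⁻¹' s) = volume s := by
  obtain ⟨g, hg⟩ := exists_eq_smul_of_isometry hf
  rw [funext hg, measure_preimage_smul]

end Isometries

end HyperbolicPlane

/-! ### Areas in the hyperbolic plane -/

theorem setLIntegral_Ioo_ofReal_of_hasDerivAt {f f' : ℝ → ℝ} {a b : ℝ} (hab : a ≤ b)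
    (hf : ContinuousOn f (Set.Icc a b)) (hf' : ∀ x ∈ Set.Ioo a b, HasDerivAt f (f' x) x)
    (h0 : ∀ x ∈ Set.Ioo a b, 0 ≤ f' x) :
    ∫⁻ x in Set.Ioo a b, ENNReal.ofReal (f' x) = ENNReal.ofReal (f b - f a) := by
  have hfi := intervalIntegral.integrableOn_deriv_of_nonneg hf hf' h0
  have h := intervalIntegral.integral_eq_sub_of_hasDerivAt_of_le hab hf hf'
    ((intervalIntegrable_iff_integrableOn_Ioc_of_le hab).2 hfi)
  rw [← h, intervalIntegral.integral_of_le hab, integral_Ioc_eq_integral_Ioo,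
    ofReal_integral_eq_lintegral_ofReal (hfi.mono_set Set.Ioo_subset_Ioc_self)]
  exact ae_restrict_of_forall_mem measurableSet_Ioo h0

theorem setLIntegral_Ioi_ofReal_inv_sq {a : ℝ} (ha : 0 < a) :
    ∫⁻ y in Set.Ioi a, ENNReal.ofReal (1 / y ^ 2) = ENNReal.ofReal (1 / a) := by
  have hd : ∀ x ∈ Set.Ici a, HasDerivAt (fun y : ℝ => -y⁻¹) (1 / x ^ 2) x := fun x hx => by
    simpa using (hasDerivAt_inv (ha.trans_le hx).ne').fun_neg
  have h0 : ∀ x ∈ Set.Ioi a, 0 ≤ 1 / x ^ 2 := fun x _ => by positivity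
  have hl : Filter.Tendsto (fun y : ℝ => -y⁻¹) Filter.atTop (nhds 0) := by
    simpa using (tendsto_inv_atTop_zero (𝕜 := ℝ)).neg
  rw [← ofReal_integral_eq_lintegral_ofReal (integrableOn_Ioi_deriv_of_nonneg' hd h0 hl)
    (ae_restrict_of_forall_mem measurableSet_Ioi h0),
    integral_Ioi_of_hasDerivAt_of_nonneg' hd h0 hl]
  simp

theorem setLIntegral_Ioo_ofReal_inv_sq {a b : ℝ} (ha : 0 < a) (hab : a ≤ b) :
    ∫⁻ y in Set.Ioo a b, ENNReal.ofReal (1 / y ^ 2) = ENNReal.ofReal (1 / a - 1 / b) := by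
  rw [setLIntegral_Ioo_ofReal_of_hasDerivAt (f := fun y : ℝ => -y⁻¹) hab]
  · congr 1
    ring
  · exact (continuousOn_inv₀.mono fun x hx => (ha.trans_le hx.1).ne').neg
  · intro x hx
    simpa using (hasDerivAt_inv (ha.trans hx.1).ne').fun_neg
  · intro x _
    positivity

theorem hasDerivAt_arcsin_comp {u : ℝ → ℝ} {u' v x : ℝ} (hu : HasDerivAt u u' x) (hv : 0 < v)
    (h : 1 - u x ^ 2 = v ^ 2) : HasDerivAt (fun x => Real.arcsin (u x)) (u' / v) x := by
  have hne_neg_one : u x ≠ -1 := fun h1 => by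
    rw [h1] at h
    nlinarith
  have hne_one : u x ≠ 1 := fun h1 => by
    rw [h1] at h
    nlinarith
  refine ((Real.hasDerivAt_arcsin hne_neg_one hne_one).comp x hu).congr_deriv ?_
  rw [h, Real.sqrt_sq hv.le, one_div_mul_eq_div]

theorem hasDerivAt_arcsin_sub_div {x₀ R x : ℝ} (hx : x ∈ Set.Ioo (x₀ - R) (x₀ + R)) :
    HasDerivAt (fun x => Real.arcsin ((x - x₀) / R)) (1 / √(R ^ 2 - (x - x₀) ^ 2)) x := by
  have hR : 0 < R := by linarith [hx.1, hx.2]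
  have hr : 0 < R ^ 2 - (x - x₀) ^ 2 := by nlinarith [hx.1, hx.2]
  have hr0 := Real.sqrt_pos.2 hr
  refine (hasDerivAt_arcsin_comp (((hasDerivAt_id x).sub_const x₀).div_const R)
    (div_pos hr0 hR) ?_).congr_deriv ?_
  · rw [div_pow (√_), Real.sq_sqrt hr.le]
    simp only [id_eq]
    field_simp
  · field_simp

theorem hasDerivAt_sqrt_one_add_sq (x : ℝ) :
    HasDerivAt (fun x : ℝ => √(1 + x ^ 2)) (x / √(1 + x ^ 2)) x := by
  have h : HasDerivAt (fun x : ℝ => 1 + x ^ 2) (2 * x) x := by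
    simpa using ((hasDerivAt_id x).pow 2).const_add 1
  exact (h.sqrt (by positivity)).congr_deriv (mul_div_mul_left _ _ two_ne_zero)

theorem hasDerivAt_mul_div_mul_sqrt {S : ℝ} (hS : S ≠ 0) (C x : ℝ) :
    HasDerivAt (fun x : ℝ => x * C / (S * √(1 + x ^ 2))) (C / (S * √(1 + x ^ 2) ^ 3)) x := by
  have hq2 : √(1 + x ^ 2) ^ 2 = 1 + x ^ 2 := Real.sq_sqrt (by positivity)
  refine (((hasDerivAt_id x).mul_const C).div ((hasDerivAt_sqrt_one_add_sq x).const_mul S)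
    (by positivity)).congr_deriv ?_
  simp only [id_eq, one_mul]
  field_simp
  rw [hq2]
  ring

/-- A primitive of the density of the shadow on the real line of a hyperbolic disk about `I`, whose
radius has hyperbolic sine `S` and hyperbolic cosine `C`. -/
def ballPrimitive (S C x : ℝ) : ℝ :=
  2 * (C * Real.arcsin (x * C / (S * √(1 + x ^ 2))) - Real.arcsin (x / S))

theorem hasDerivAt_ballPrimitive {S C x : ℝ} (hC : C ^ 2 = 1 + S ^ 2) (hx : x ∈ Set.Ioo (-S) S) :
    HasDerivAt (ballPrimitive S C) (2 * √(S ^ 2 - x ^ 2) / (1 + x ^ 2)) x := by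
  have hS : 0 < S := by linarith [hx.1, hx.2]
  have hr : 0 < S ^ 2 - x ^ 2 := by nlinarith [hx.1, hx.2]
  have hq2 : √(1 + x ^ 2) ^ 2 = 1 + x ^ 2 := Real.sq_sqrt (by positivity)
  have hρ2 : √(S ^ 2 - x ^ 2) ^ 2 = S ^ 2 - x ^ 2 := Real.sq_sqrt hr.le
  have d₁ := hasDerivAt_arcsin_comp (hasDerivAt_mul_div_mul_sqrt hS.ne' C x)
    (v := √(S ^ 2 - x ^ 2) / (S * √(1 + x ^ 2))) (by positivity) (by
      field_simp
      rw [hρ2, hq2]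
      linear_combination -x ^ 2 * hC)
  have d₂ := hasDerivAt_arcsin_sub_div (x₀ := 0) (R := S) (x := x) (by simpa using hx)
  simp only [sub_zero] at d₂
  refine (((d₁.const_mul C).sub d₂).const_mul 2).congr_deriv ?_
  field_simp
  rw [hρ2, hq2, hC]
  ring

theorem continuous_ballPrimitive {S : ℝ} (hS : S ≠ 0) (C : ℝ) : Continuous (ballPrimitive S C) := by
  have hq (x : ℝ) : S * √(1 + x ^ 2) ≠ 0 := mul_ne_zero hS (by positivity)
  have h₁ : Continuous fun x : ℝ => x * C / (S * √(1 + x ^ 2)) :=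
    .div (by fun_prop) (by fun_prop) hq
  exact continuous_const.mul ((continuous_const.mul (Real.continuous_arcsin.comp h₁)).sub
    (Real.continuous_arcsin.comp (continuous_id.div_const S)))

theorem ballPrimitive_self {S C : ℝ} (hS : 0 < S) (hC0 : 0 < C) (hC : C ^ 2 = 1 + S ^ 2) :
    ballPrimitive S C S = Real.pi * (C - 1) := by
  rw [ballPrimitive, ← hC, Real.sqrt_sq hC0.le, div_self hS.ne', div_self (by positivity),
    Real.arcsin_one]
  ring

theorem ballPrimitive_neg (S C x : ℝ) : ballPrimitive S C (-x) = -ballPrimitive S C x := by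
  simp only [ballPrimitive, neg_mul, neg_div, neg_sq, Real.arcsin_neg]
  ring

namespace HyperbolicPlane

open UpperHalfPlane

theorem volume_eq_lintegral_lintegral {s : Set ℍ} {t : Set (ℝ × ℝ)} (ht : MeasurableSet t)
    (hst : ∀ z : ℍ, z ∈ s ↔ (z.re, z.im) ∈ t) (hpos : ∀ q ∈ t, 0 < q.2) :
    volume s = ∫⁻ x : ℝ, ∫⁻ y in {y | (x, y) ∈ t}, ENNReal.ofReal (1 / y ^ 2) := by
  have himg : UpperHalfPlane.coe '' s = Complex.measurableEquivRealProd ⁻¹' t := by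
    ext w
    constructor
    · rintro ⟨z, hz, rfl⟩
      exact (hst z).1 hz
    · intro hw
      exact ⟨⟨w, hpos _ hw⟩, (hst _).2 hw, rfl⟩
  have hdensity (z : ℂ) :
      (((1 / ‖z.im‖₊) ^ 2 : NNReal) : ℝ≥0∞) = ENNReal.ofReal (1 / z.im ^ 2) := by
    rw [← ENNReal.ofReal_coe_nnreal]
    congr 1
    push_cast
    rw [div_pow, one_pow, Real.norm_eq_abs, sq_abs]
  have hF : Measurable fun q : ℝ × ℝ => ENNReal.ofReal (1 / q.2 ^ 2) := by fun_prop
  calc volume s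
      = ∫⁻ z in Complex.measurableEquivRealProd ⁻¹' t,
          ENNReal.ofReal (1 / (Complex.measurableEquivRealProd z).2 ^ 2) := by
        rw [volume_eq_lintegral, himg]
        exact lintegral_congr fun z => by simpa using hdensity z
    _ = ∫⁻ q, t.indicator (fun q => ENNReal.ofReal (1 / q.2 ^ 2)) q := by
        rw [Complex.volume_preserving_equiv_real_prod.setLIntegral_comp_preimage ht hF,
          lintegral_indicator ht]
    _ = ∫⁻ x, ∫⁻ y, t.indicator (fun q => ENNReal.ofReal (1 / q.2 ^ 2)) (x, y) := by
        rw [Measure.volume_eq_prod, lintegral_prod _ (hF.indicator ht).aemeasurable]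
    _ = ∫⁻ x, ∫⁻ y in {y | (x, y) ∈ t}, ENNReal.ofReal (1 / y ^ 2) :=
        lintegral_congr fun x => lintegral_indicator (measurable_prodMk_left ht) _

theorem mem_ball_I_iff {z : ℍ} {r : ℝ} (hr : 0 < r) :
    z ∈ Metric.ball I r ↔ z.re ^ 2 + (z.im - Real.cosh r) ^ 2 < Real.sinh r ^ 2 := by
  rw [Metric.mem_ball, dist_lt_iff_dist_coe_center_lt, I_im, one_mul,
    ← sq_lt_sq₀ dist_nonneg (Real.sinh_pos_iff.2 hr).le, Complex.dist_eq, Complex.sq_norm,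
    Complex.normSq_apply]
  simp [← sq]

theorem setLIntegral_disk_section {S C x : ℝ} (hC0 : 0 < C) (hC : C ^ 2 = 1 + S ^ 2)
    (hx : x ∈ Set.Ioo (-S) S) :
    ∫⁻ y in {y | x ^ 2 + (y - C) ^ 2 < S ^ 2}, ENNReal.ofReal (1 / y ^ 2) =
      ENNReal.ofReal (2 * √(S ^ 2 - x ^ 2) / (1 + x ^ 2)) := by
  have hr : 0 < S ^ 2 - x ^ 2 := by nlinarith [hx.1, hx.2]
  set ρ := √(S ^ 2 - x ^ 2)
  have hρ : 0 < ρ := Real.sqrt_pos.2 hr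
  have hρ2 : ρ ^ 2 = S ^ 2 - x ^ 2 := Real.sq_sqrt hr.le
  have hρC : ρ < C := by nlinarith [sq_nonneg x]
  have hsec : {y | x ^ 2 + (y - C) ^ 2 < S ^ 2} = Set.Ioo (C - ρ) (C + ρ) := by
    ext y
    rw [Set.mem_ofPred_eq, ← lt_sub_iff_add_lt', ← hρ2, sq_lt_sq, abs_of_pos hρ, abs_lt,
      Set.mem_Ioo]
    constructor <;> rintro ⟨h1, h2⟩ <;> constructor <;> linarith
  rw [hsec, setLIntegral_Ioo_ofReal_inv_sq (by linarith) (by linarith)]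
  congr 1
  have h1 : C - ρ ≠ 0 := by linarith
  have h2 : C + ρ ≠ 0 := by linarith
  have h3 : 1 + x ^ 2 ≠ 0 := by positivity
  field_simp
  linear_combination (-2) * ρ * hC + 2 * ρ * hρ2

theorem le_volume_ball_I {r : ℝ} (hr : 0 < r) :
    ENNReal.ofReal (2 * Real.pi * (Real.cosh r - 1)) ≤ volume (Metric.ball I r) := by
  have hS : 0 < Real.sinh r := Real.sinh_pos_iff.2 hr
  have hC0 : 0 < Real.cosh r := Real.cosh_pos r
  have hC : Real.cosh r ^ 2 = 1 + Real.sinh r ^ 2 := Real.cosh_sq' r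
  set S := Real.sinh r
  set C := Real.cosh r
  have hpos : ∀ q ∈ {q : ℝ × ℝ | q.1 ^ 2 + (q.2 - C) ^ 2 < S ^ 2}, 0 < q.2 := by
    intro q hq
    rw [Set.mem_ofPred_eq] at hq
    by_contra! h
    nlinarith [sq_nonneg q.1]
  calc ENNReal.ofReal (2 * Real.pi * (C - 1))
      = ENNReal.ofReal (ballPrimitive S C S - ballPrimitive S C (-S)) := by
        rw [ballPrimitive_neg, ballPrimitive_self hS hC0 hC]
        congr 1
        ring
    _ = ∫⁻ x in Set.Ioo (-S) S, ENNReal.ofReal (2 * √(S ^ 2 - x ^ 2) / (1 + x ^ 2)) :=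
        (setLIntegral_Ioo_ofReal_of_hasDerivAt (by linarith)
          (continuous_ballPrimitive hS.ne' C).continuousOn
          (fun x hx => hasDerivAt_ballPrimitive hC hx) (fun x _ => by positivity)).symm
    _ = ∫⁻ x in Set.Ioo (-S) S, ∫⁻ y in {y | x ^ 2 + (y - C) ^ 2 < S ^ 2},
          ENNReal.ofReal (1 / y ^ 2) :=
        (setLIntegral_congr_fun measurableSet_Ioo fun x hx =>
          setLIntegral_disk_section hC0 hC hx).symm
    _ ≤ ∫⁻ x, ∫⁻ y in {y | x ^ 2 + (y - C) ^ 2 < S ^ 2}, ENNReal.ofReal (1 / y ^ 2) :=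
        setLIntegral_le_lintegral _ _
    _ = volume (Metric.ball I r) :=
        (volume_eq_lintegral_lintegral
          (isOpen_lt (by fun_prop) (by fun_prop)).measurableSet (fun _ => mem_ball_I_iff hr)
          hpos).symm

theorem le_volume_ball (p : ℍ) {r : ℝ} (hr : 0 < r) :
    ENNReal.ofReal (2 * Real.pi * (Real.cosh r - 1)) ≤ volume (Metric.ball p r) := by
  obtain ⟨g, hg⟩ := MulAction.exists_smul_eq (Matrix.SpecialLinearGroup (Fin 2) ℝ) p I
  rw [← volume_preimage_of_isometry (isometry_smul ℍ g⁻¹), Set.preimage_smul, inv_inv,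
    Metric.smul_ball, hg]
  exact le_volume_ball_I hr

theorem setLIntegral_section_above_circle {R x : ℝ} (hx : x ^ 2 < R ^ 2) :
    ∫⁻ y in {y | 0 < y ∧ R ^ 2 ≤ x ^ 2 + y ^ 2}, ENNReal.ofReal (1 / y ^ 2) =
      ENNReal.ofReal (1 / √(R ^ 2 - x ^ 2)) := by
  have hr : 0 < √(R ^ 2 - x ^ 2) := Real.sqrt_pos.2 (sub_pos.2 hx)
  have hsec : {y | 0 < y ∧ R ^ 2 ≤ x ^ 2 + y ^ 2} = Set.Ici (√(R ^ 2 - x ^ 2)) := by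
    ext y
    rw [Set.mem_Ici, Set.mem_ofPred_eq]
    constructor
    · rintro ⟨hy, h⟩
      exact Real.sqrt_le_iff.2 ⟨hy.le, by linarith⟩
    · intro h
      have hy := hr.trans_le h
      exact ⟨hy, by linarith [(Real.sqrt_le_left hy.le).1 h]⟩
  rw [hsec, setLIntegral_congr Ioi_ae_eq_Ici.symm, setLIntegral_Ioi_ofReal_inv_sq hr]

theorem volume_idealTriangle (x₀ : ℝ) {R : ℝ} (hR : 0 < R) :
    volume {z : ℍ | (z.re - x₀) ^ 2 ≤ R ^ 2 ∧ R ^ 2 ≤ (z.re - x₀) ^ 2 + z.im ^ 2} =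
      ENNReal.ofReal Real.pi := by
  let t : Set (ℝ × ℝ) := {q | 0 < q.2} ∩ {q | (q.1 - x₀) ^ 2 ≤ R ^ 2} ∩
    {q | R ^ 2 ≤ (q.1 - x₀) ^ 2 + q.2 ^ 2}
  have ht : MeasurableSet t := ((isOpen_lt (by fun_prop) (by fun_prop)).measurableSet.inter
    (isClosed_le (by fun_prop) (by fun_prop)).measurableSet).inter
    (isClosed_le (by fun_prop) (by fun_prop)).measurableSet
  let G (x : ℝ) : ℝ≥0∞ :=
    ∫⁻ y in {y | 0 < y ∧ R ^ 2 ≤ (x - x₀) ^ 2 + y ^ 2}, ENNReal.ofReal (1 / y ^ 2)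
  have mem_Icc_iff (x : ℝ) : x ∈ Set.Icc (x₀ - R) (x₀ + R) ↔ (x - x₀) ^ 2 ≤ R ^ 2 := by
    rw [sq_le_sq, abs_of_pos hR, abs_le, Set.mem_Icc]
    constructor <;> rintro ⟨h1, h2⟩ <;> constructor <;> linarith
  have hsec (x : ℝ) : ∫⁻ y in {y | (x, y) ∈ t}, ENNReal.ofReal (1 / y ^ 2) =
      (Set.Icc (x₀ - R) (x₀ + R)).indicator G x := by
    by_cases hx : (x - x₀) ^ 2 ≤ R ^ 2
    · rw [Set.indicator_of_mem ((mem_Icc_iff x).2 hx)]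
      simp [t, G, hx]
    · rw [Set.indicator_of_notMem (mt (mem_Icc_iff x).1 hx)]
      simp [t, hx]
  calc volume {z : ℍ | (z.re - x₀) ^ 2 ≤ R ^ 2 ∧ R ^ 2 ≤ (z.re - x₀) ^ 2 + z.im ^ 2}
      = ∫⁻ x in Set.Icc (x₀ - R) (x₀ + R), G x := by
        rw [volume_eq_lintegral_lintegral ht (fun z => by simp [t, z.im_pos])
          (fun q hq => hq.1.1), lintegral_congr hsec, lintegral_indicator measurableSet_Icc]
    _ = ∫⁻ x in Set.Ioo (x₀ - R) (x₀ + R), ENNReal.ofReal (1 / √(R ^ 2 - (x - x₀) ^ 2)) := by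
        rw [setLIntegral_congr Ioo_ae_eq_Icc.symm]
        refine setLIntegral_congr_fun measurableSet_Ioo fun x hx => ?_
        exact setLIntegral_section_above_circle (by nlinarith [hx.1, hx.2])
    _ = ENNReal.ofReal (Real.arcsin ((x₀ + R - x₀) / R) - Real.arcsin ((x₀ - R - x₀) / R)) :=
        setLIntegral_Ioo_ofReal_of_hasDerivAt (f := fun x => Real.arcsin ((x - x₀) / R))
          (by linarith) (Real.continuous_arcsin.comp (by fun_prop)).continuousOn
          (fun x hx => hasDerivAt_arcsin_sub_div hx) (fun x _ => by positivity)
    _ = ENNReal.ofReal Real.pi := by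
        rw [add_sub_cancel_left, sub_sub_cancel_left, neg_div, div_self hR.ne', Real.arcsin_neg,
          Real.arcsin_one, sub_neg_eq_add, add_halves]

theorem volume_re_eq_zero : volume {z : ℍ | z.re = 0} = 0 := by
  rw [volume_eq_lintegral_lintegral (t := {q | 0 < q.2} ∩ {q | q.1 = 0})
    ((isOpen_lt (by fun_prop) (by fun_prop)).measurableSet.inter
      (isClosed_eq (by fun_prop) (by fun_prop)).measurableSet)
    (fun z => by simp [z.im_pos]) (fun q hq => hq.1), ← lintegral_zero (μ := (volume : Measure ℝ))]
  refine lintegral_congr_ae ?_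
  filter_upwards [Measure.ae_ne volume (0 : ℝ)] with x hx
  simp [hx]

/-- The geodesic triangle with vertices `a`, `b`, `c`: in the hyperboloid model, the points of the
convex cone spanned by the vertices. A point `z` of the hyperboloid is represented by the function
`v ↦ cosh (dist z v)`. -/
def geodesicTriangle (a b c : ℍ) : Set ℍ :=
  {q | ∃ k l m : ℝ, 0 ≤ k ∧ 0 ≤ l ∧ 0 ≤ m ∧ ∀ v, Real.cosh (dist q v) =
    k * Real.cosh (dist a v) + l * Real.cosh (dist b v) + m * Real.cosh (dist c v)}

theorem smul_mem_geodesicTriangle {G : Type*} [Group G] [MulAction G ℍ] [IsIsometricSMul G ℍ]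
    (g : G) {a b c q : ℍ} (h : q ∈ geodesicTriangle a b c) :
    g • q ∈ geodesicTriangle (g • a) (g • b) (g • c) := by
  obtain ⟨k, l, m, hk, hl, hm, h⟩ := h
  have dist_inv_smul (w v : ℍ) : dist w (g⁻¹ • v) = dist (g • w) v := by
    rw [← dist_smul g, smul_inv_smul]
  exact ⟨k, l, m, hk, hl, hm, fun v => by simpa only [dist_inv_smul] using h (g⁻¹ • v)⟩

theorem volume_geodesicTriangle_smul_le {G : Type*} [Group G] [MulAction G ℍ]
    [IsIsometricSMul G ℍ] (g : G) (a b c : ℍ) :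
    volume (geodesicTriangle a b c) ≤ volume (geodesicTriangle (g • a) (g • b) (g • c)) := by
  rw [← volume_preimage_of_isometry (isometry_smul ℍ g) (geodesicTriangle (g • a) _ _)]
  exact measure_mono fun q hq => smul_mem_geodesicTriangle g hq

/-- In suitable coordinates `z ↦ (1, re z, |z|²) / im z` on the hyperboloid, the point `v` acts as
a linear form. -/
theorem two_mul_im_mul_cosh_dist (z v : ℍ) : 2 * v.im * Real.cosh (dist z v) =
    (z.re ^ 2 + z.im ^ 2 - 2 * z.re * v.re + (v.re ^ 2 + v.im ^ 2)) / z.im := by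
  rw [cosh_dist']
  field_simp [z.im_ne_zero, v.im_ne_zero]
  ring

theorem exists_linearForm_eq_of_mem_geodesicTriangle {a b c q : ℍ}
    (h : q ∈ geodesicTriangle a b c) :
    ∃ k l m : ℝ, 0 ≤ k ∧ 0 ≤ l ∧ 0 ≤ m ∧ ∀ α β γ : ℝ,
      (α + β * q.re + γ * (q.re ^ 2 + q.im ^ 2)) / q.im =
        k * ((α + β * a.re + γ * (a.re ^ 2 + a.im ^ 2)) / a.im) +
        l * ((α + β * b.re + γ * (b.re ^ 2 + b.im ^ 2)) / b.im) +
        m * ((α + β * c.re + γ * (c.re ^ 2 + c.im ^ 2)) / c.im) := by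
  obtain ⟨k, l, m, hk, hl, hm, h⟩ := h
  refine ⟨k, l, m, hk, hl, hm, fun α β γ => ?_⟩
  have key (s y : ℝ) (hy : 0 < y) :
      (q.re ^ 2 + q.im ^ 2 - 2 * q.re * s + (s ^ 2 + y ^ 2)) / q.im =
        k * ((a.re ^ 2 + a.im ^ 2 - 2 * a.re * s + (s ^ 2 + y ^ 2)) / a.im) +
        l * ((b.re ^ 2 + b.im ^ 2 - 2 * b.re * s + (s ^ 2 + y ^ 2)) / b.im) +
        m * ((c.re ^ 2 + c.im ^ 2 - 2 * c.re * s + (s ^ 2 + y ^ 2)) / c.im) := by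
    have e (z : ℍ) := two_mul_im_mul_cosh_dist z ⟨⟨s, y⟩, hy⟩
    simp only [mk_re, mk_im] at e
    rw [← e q, ← e a, ← e b, ← e c, h]
    ring
  have k₁ := key 0 1 one_pos
  have k₂ := key 0 2 two_pos
  have k₃ := key 1 1 one_pos
  linear_combination γ * k₁ + (α - γ) / 3 * (k₂ - k₁) + β / 2 * ((k₂ - k₁) / 3 - (k₃ - k₁))

/-- Convexity of half-planes, as `α + β re z + γ |z|² = 0` is the general equation of a geodesic. -/
theorem nonneg_of_mem_geodesicTriangle {a b c q : ℍ} (h : q ∈ geodesicTriangle a b c) {α β γ : ℝ}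
    (ha : 0 ≤ α + β * a.re + γ * (a.re ^ 2 + a.im ^ 2))
    (hb : 0 ≤ α + β * b.re + γ * (b.re ^ 2 + b.im ^ 2))
    (hc : 0 ≤ α + β * c.re + γ * (c.re ^ 2 + c.im ^ 2)) :
    0 ≤ α + β * q.re + γ * (q.re ^ 2 + q.im ^ 2) := by
  obtain ⟨k, l, m, hk, hl, hm, h⟩ := exists_linearForm_eq_of_mem_geodesicTriangle h
  have hdiv : 0 ≤ (α + β * q.re + γ * (q.re ^ 2 + q.im ^ 2)) / q.im := by
    rw [h]
    have := div_nonneg ha a.im_pos.le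
    have := div_nonneg hb b.im_pos.le
    have := div_nonneg hc c.im_pos.le
    positivity
  rwa [le_div_iff₀ q.im_pos, zero_mul] at hdiv

theorem volume_geodesicTriangle_eq_zero {a b c : ℍ} (ha : a.re = 0) (hb : b.re = 0)
    (hc : c.re = 0) : volume (geodesicTriangle a b c) = 0 := by
  refine measure_mono_null (fun q hq => ?_) volume_re_eq_zero
  have h₁ := nonneg_of_mem_geodesicTriangle hq (α := 0) (β := 1) (γ := 0)
    (by simp [ha]) (by simp [hb]) (by simp [hc])
  have h₂ := nonneg_of_mem_geodesicTriangle hq (α := 0) (β := -1) (γ := 0)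
    (by simp [ha]) (by simp [hb]) (by simp [hc])
  exact le_antisymm (by linarith) (by linarith)

theorem volume_geodesicTriangle_self_left (a c : ℍ) : volume (geodesicTriangle a a c) = 0 := by
  obtain ⟨g, ha, hc, -⟩ := exists_smul_eq_I_and_re_smul_eq_zero a c
  refine le_antisymm ((volume_geodesicTriangle_smul_le g a a c).trans_eq ?_) zero_le
  exact volume_geodesicTriangle_eq_zero (by simp [ha]) (by simp [ha]) hc

theorem volume_geodesicTriangle_self_right (a b : ℍ) : volume (geodesicTriangle a b a) = 0 := by
  refine measure_mono_null (fun q hq => ?_) (volume_geodesicTriangle_self_left a b)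
  obtain ⟨k, l, m, hk, hl, hm, h⟩ := hq
  exact ⟨k, m, l, hk, hm, hl, fun v => by rw [h v]; ring⟩

/-- The side `[I, c]` of the triangle lies on the imaginary axis, and the ideal triangle is bounded
by the circle through `a` and `I` and by the vertical lines through its endpoints. -/
theorem volume_geodesicTriangle_I_le {a c : ℍ} (hc : c.re = 0) (hc1 : 1 ≤ c.im) :
    volume (geodesicTriangle a I c) ≤ ENNReal.ofReal Real.pi := by
  by_cases ha : a.re = 0
  · rw [volume_geodesicTriangle_eq_zero ha I_re hc]
    exact zero_le
  set x₀ := (a.re ^ 2 + a.im ^ 2 - 1) / (2 * a.re) with hx₀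
  have circle_a : a.re ^ 2 + a.im ^ 2 - 1 = 2 * a.re * x₀ := by rw [hx₀]; field_simp
  set R := √(1 + x₀ ^ 2)
  have hR : 0 < R := by positivity
  have hR2 : R ^ 2 = 1 + x₀ ^ 2 := Real.sq_sqrt (by positivity)
  obtain ⟨ha_left, ha_right⟩ : -R ≤ a.re - x₀ ∧ a.re - x₀ ≤ R :=
    abs_le_of_sq_le_sq' (by nlinarith) hR.le
  obtain ⟨hI_left, hI_right⟩ : -R ≤ -x₀ ∧ -x₀ ≤ R := abs_le_of_sq_le_sq' (by nlinarith) hR.le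
  refine (measure_mono fun q hq => ?_).trans (volume_idealTriangle x₀ hR).le
  have left : 0 ≤ R - x₀ + 1 * q.re + 0 * (q.re ^ 2 + q.im ^ 2) :=
    nonneg_of_mem_geodesicTriangle hq (by linarith) (by rw [I_re]; linarith)
      (by rw [hc]; linarith)
  have right : 0 ≤ R + x₀ + (-1) * q.re + 0 * (q.re ^ 2 + q.im ^ 2) :=
    nonneg_of_mem_geodesicTriangle hq (by linarith) (by rw [I_re]; linarith)
      (by rw [hc]; linarith)
  have outside : 0 ≤ -1 + (-2 * x₀) * q.re + 1 * (q.re ^ 2 + q.im ^ 2) :=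
    nonneg_of_mem_geodesicTriangle hq (by linarith) (by simp only [I_re, I_im]; linarith)
      (by rw [hc]; nlinarith)
  exact ⟨sq_le_sq' (by linarith) (by linarith), by nlinarith⟩

theorem volume_geodesicTriangle_le (a b c : ℍ) :
    volume (geodesicTriangle a b c) ≤ ENNReal.ofReal Real.pi := by
  obtain ⟨g, hb, hc, hc1⟩ := exists_smul_eq_I_and_re_smul_eq_zero b c
  refine (volume_geodesicTriangle_smul_le g a b c).trans ?_
  rw [hb]
  exact volume_geodesicTriangle_I_le hc hc1

theorem sum_volume_geodesicTriangle_le {m : ℕ} (hm : 2 ≤ m) {w : ℕ → ℍ} (hw : w m = w 0) :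
    ∑ j ∈ Finset.range m, volume (geodesicTriangle (w 0) (w j) (w (j + 1))) ≤
      ENNReal.ofReal ((m - 2) * Real.pi) := by
  obtain ⟨n, rfl⟩ := Nat.exists_eq_add_of_le' hm
  rw [Finset.sum_range_succ, Finset.sum_range_succ', zero_add,
    volume_geodesicTriangle_self_left, hw, volume_geodesicTriangle_self_right, add_zero, add_zero]
  calc ∑ j ∈ Finset.range n, volume (geodesicTriangle (w 0) (w (j + 1)) (w (j + 1 + 1)))
      ≤ ∑ _j ∈ Finset.range n, ENNReal.ofReal Real.pi :=
        Finset.sum_le_sum fun j _ => volume_geodesicTriangle_le _ _ _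
    _ = ENNReal.ofReal (((n + 2 : ℕ) - 2) * Real.pi) := by
        rw [Finset.sum_const, Finset.card_range, nsmul_eq_mul, Nat.cast_add, Nat.cast_ofNat,
          add_sub_cancel_right, ENNReal.ofReal_mul n.cast_nonneg, ENNReal.ofReal_natCast]

end HyperbolicPlane

/-! ### Maps of the hyperbolic plane at bounded distance from the identity -/

theorem div_mem_slitPlane_of_norm_sub_lt {a b : ℂ} (h : ‖a - b‖ < ‖b‖) :
    a / b ∈ Complex.slitPlane := by
  have hb : b ≠ 0 := norm_pos_iff.1 ((norm_nonneg _).trans_lt h)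
  refine Complex.ball_one_subset_slitPlane (mem_ball_iff_norm.2 ?_)
  rw [div_sub_one hb, norm_div]
  exact (div_lt_one (norm_pos_iff.2 hb)).2 h

theorem eq_add_mul_I_of_exp_eq {m : ℝ → ℂ} (hm : Continuous m) {a : ℂ}
    (h : ∀ θ : ℝ, Complex.exp (m θ) = a * Complex.exp (θ * Complex.I)) (θ : ℝ) :
    m θ = m 0 + θ * Complex.I := by
  refine congrFun (Complex.isCoveringMap_exp.eq_of_comp_eq
    (g₂ := fun θ : ℝ => m 0 + θ * Complex.I) hm (by fun_prop) ?_ 0 (by simp)) θ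
  ext θ
  simp [Complex.exp_add, h]

theorem exists_eq_zero_of_norm_sub_lt {X : Type*} [TopologicalSpace X] [SimplyConnectedSpace X]
    [LocallyPathConnectedSpace X] {G : X → ℂ} (hG : Continuous G) {c : ℝ → X} (hc : Continuous c)
    (hc_loop : c (2 * Real.pi) = c 0) {ρ : ℝ}
    (h : ∀ θ : ℝ, ‖G (c θ) - ρ * Complex.exp (θ * Complex.I)‖ < ρ) : ∃ x, G x = 0 := by
  by_contra! hG0
  have hρ : 0 < ρ := (norm_nonneg _).trans_lt (h 0)
  obtain ⟨l, ⟨-, hl⟩, -⟩ := Complex.isCoveringMapOn_exp.existsUnique_continuousMap_lifts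
    (⟨G, hG⟩ : C(X, ℂ)) (Complex.exp_log (hG0 (c 0))) hG0
  replace hl (x : X) : Complex.exp (l x) = G x := congrFun hl x
  set e : ℝ → ℂ := fun θ => ρ * Complex.exp (θ * Complex.I) with he
  have e_ne (θ : ℝ) : e θ ≠ 0 := by simp [he, hρ.ne']
  have slit (θ : ℝ) : G (c θ) / e θ ∈ Complex.slitPlane :=
    div_mem_slitPlane_of_norm_sub_lt ((h θ).trans_eq (by
      rw [norm_mul, Complex.norm_exp_ofReal_mul_I, mul_one, Complex.norm_real,
        Real.norm_of_nonneg hρ.le]))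
  let m : ℝ → ℂ := fun θ => l (c θ) - Complex.log (G (c θ) / e θ)
  have m_cont : Continuous m := (l.continuous.comp hc).sub
    (((hG.comp hc).div (by fun_prop) e_ne).clog slit)
  have m_exp (θ : ℝ) : Complex.exp (m θ) = e θ := by
    rw [Complex.exp_sub, hl, Complex.exp_log (Complex.slitPlane_ne_zero (slit θ)),
      div_div_cancel₀ (hG0 _)]
  have m_loop : m (2 * Real.pi) = m 0 := by
    simp [m, he, hc_loop, Complex.exp_two_pi_mul_I]
  have m_turn := eq_add_mul_I_of_exp_eq m_cont m_exp (2 * Real.pi)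
  simp [m_loop, Real.pi_ne_zero] at m_turn

namespace HyperbolicPlane

open UpperHalfPlane

open scoped ComplexConjugate

/-- The isometry from the hyperbolic plane to the Poincaré disk which sends `y` to the center. -/
def diskCoord (y x : ℍ) : ℂ := ((x : ℂ) - y) / (x - conj (y : ℂ))

theorem sub_conj_ne_zero (x y : ℍ) : (x : ℂ) - conj (y : ℂ) ≠ 0 := fun h => by
  have him : x.im + y.im = 0 := by simpa using congrArg Complex.im h
  linarith [x.im_pos, y.im_pos]

theorem continuous_diskCoord (y : ℍ) : Continuous (diskCoord y) :=
  Continuous.div (by fun_prop) (by fun_prop) fun x => sub_conj_ne_zero x y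

theorem diskCoord_eq_zero {x y : ℍ} : diskCoord y x = 0 ↔ x = y := by
  rw [diskCoord, div_eq_zero_iff, or_iff_left (sub_conj_ne_zero x y), sub_eq_zero,
    UpperHalfPlane.ext_iff]

theorem one_sub_normSq_diskCoord (y x : ℍ) : 1 - Complex.normSq (diskCoord y x) =
    4 * x.im * y.im / Complex.normSq (x - conj (y : ℂ)) := by
  rw [diskCoord, map_div₀, one_sub_div (Complex.normSq_eq_zero.not.2 (sub_conj_ne_zero x y))]
  congr 1
  simp only [Complex.normSq_apply, Complex.sub_re, Complex.sub_im, Complex.conj_re,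
    Complex.conj_im, coe_re, coe_im]
  ring

theorem normSq_diskCoord_sub (y x w : ℍ) : Complex.normSq (diskCoord y x - diskCoord y w) =
    Real.sinh (dist x w / 2) ^ 2 * (1 - Complex.normSq (diskCoord y x)) *
      (1 - Complex.normSq (diskCoord y w)) := by
  have hx : Complex.normSq (x - conj (y : ℂ)) ≠ 0 :=
    Complex.normSq_eq_zero.not.2 (sub_conj_ne_zero x y)
  have hw : Complex.normSq (w - conj (y : ℂ)) ≠ 0 :=
    Complex.normSq_eq_zero.not.2 (sub_conj_ne_zero w y)
  have diskCoord_sub : diskCoord y x - diskCoord y w =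
      ((x : ℂ) - w) * (y - conj (y : ℂ)) / ((x - conj (y : ℂ)) * (w - conj (y : ℂ))) := by
    have := sub_conj_ne_zero x y
    have := sub_conj_ne_zero w y
    rw [diskCoord, diskCoord]
    field_simp
    ring
  have normSq_sub_conj : Complex.normSq (y - conj (y : ℂ)) = 4 * y.im ^ 2 := by
    rw [Complex.sub_conj, Complex.normSq_mul, Complex.normSq_I, Complex.normSq_ofReal, coe_im]
    ring
  rw [one_sub_normSq_diskCoord, one_sub_normSq_diskCoord, diskCoord_sub, map_div₀, map_mul,
    map_mul, normSq_sub_conj, sinh_half_dist, div_pow, mul_pow, Real.sq_sqrt (by positivity),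
    Complex.dist_eq, Complex.sq_norm]
  field_simp
  norm_num

theorem exists_continuous_rightInverse_diskCoord (y : ℍ) :
    ∃ x : Metric.ball (0 : ℂ) 1 → ℍ, Continuous x ∧ ∀ u, diskCoord y (x u) = u := by
  let num : Metric.ball (0 : ℂ) 1 → ℂ := fun u => y - u * conj (y : ℂ)
  have norm_lt (u : Metric.ball (0 : ℂ) 1) : ‖(u : ℂ)‖ < 1 := mem_ball_zero_iff.1 u.2
  have one_sub_ne (u : Metric.ball (0 : ℂ) 1) : 1 - (u : ℂ) ≠ 0 := fun h =>
    (norm_lt u).ne (by rw [← sub_eq_zero.1 h, norm_one])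
  have im_eq (u : Metric.ball (0 : ℂ) 1) : (num u / (1 - u)).im =
      y.im * (1 - ‖(u : ℂ)‖ ^ 2) / Complex.normSq (1 - u) := by
    rw [Complex.div_im, div_sub_div_same, Complex.sq_norm]
    congr 1
    simp only [num, Complex.normSq_apply, Complex.sub_im, Complex.sub_re, Complex.mul_im,
      Complex.mul_re, Complex.conj_re, Complex.conj_im, Complex.one_re, Complex.one_im, coe_re,
      coe_im]
    ring
  have im_pos (u : Metric.ball (0 : ℂ) 1) : 0 < (num u / (1 - u)).im := by
    rw [im_eq]
    have : 0 < 1 - ‖(u : ℂ)‖ ^ 2 :=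
      sub_pos.2 (pow_lt_one₀ (norm_nonneg _) (norm_lt u) two_ne_zero)
    exact div_pos (mul_pos y.im_pos this) (Complex.normSq_pos.2 (one_sub_ne u))
  refine ⟨fun u => ⟨_, im_pos u⟩, Continuous.upperHalfPlaneMk
    (Continuous.div (by fun_prop) (by fun_prop) one_sub_ne) im_pos, fun u => ?_⟩
  have hu := one_sub_ne u
  have sub_eq : num u / (1 - u) - y = u * ((y - conj (y : ℂ)) / (1 - u)) := by
    field_simp
    ring
  have sub_conj_eq : num u / (1 - u) - conj (y : ℂ) = (y - conj (y : ℂ)) / (1 - u) := by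
    field_simp
    ring
  rw [diskCoord, coe_mk, sub_eq, sub_conj_eq]
  exact mul_div_cancel_right₀ _ (div_ne_zero (sub_conj_ne_zero y y) hu)

theorem norm_diskCoord_sub_lt {y x w : ℍ} {C : ℝ} (hC : dist x w ≤ C) {ρ : ℝ}
    (hρ : ‖diskCoord y w‖ = ρ) (hρC : Real.sinh (C / 2) ^ 2 * (1 - ρ ^ 2) < ρ ^ 2) :
    ‖diskCoord y x - diskCoord y w‖ < ρ := by
  have one_sub_nonneg (v : ℍ) : 0 ≤ 1 - ‖diskCoord y v‖ ^ 2 := by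
    rw [Complex.sq_norm, one_sub_normSq_diskCoord]
    exact div_nonneg (by positivity) (Complex.normSq_nonneg _)
  refine lt_of_pow_lt_pow_left₀ 2 (hρ ▸ norm_nonneg _) ?_
  calc ‖diskCoord y x - diskCoord y w‖ ^ 2
      = Real.sinh (dist x w / 2) ^ 2 * (1 - ‖diskCoord y x‖ ^ 2) * (1 - ρ ^ 2) := by
        rw [← hρ, Complex.sq_norm, Complex.sq_norm, Complex.sq_norm, normSq_diskCoord_sub]
    _ ≤ Real.sinh (C / 2) ^ 2 * 1 * (1 - ρ ^ 2) := by
        have hw := hρ ▸ one_sub_nonneg w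
        have hx := one_sub_nonneg x
        have : 0 ≤ Real.sinh (dist x w / 2) := Real.sinh_nonneg_iff.2 (by positivity)
        have sinh_le : Real.sinh (dist x w / 2) ≤ Real.sinh (C / 2) :=
          Real.sinh_le_sinh.2 (by linarith)
        gcongr
        exact sub_le_self _ (sq_nonneg _)
    _ < ρ ^ 2 := by rwa [mul_one]

/-- Otherwise `diskCoord y ∘ f` would have no zero, although on a large circle around `y` it is
close enough to `diskCoord y` to wind once around `0`. -/
theorem surjective_of_dist_le {f : ℍ → ℍ} (hf : Continuous f) {C : ℝ}
    (hC : ∀ x, dist (f x) x ≤ C) : Function.Surjective f := by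
  intro y
  set K := Real.sinh (C / 2) ^ 2
  obtain ⟨ρ, hρ0, hρ1, hρK⟩ : ∃ ρ : ℝ, 0 < ρ ∧ ρ < 1 ∧ K * (1 - ρ ^ 2) < ρ ^ 2 := by
    have : 0 ≤ K := sq_nonneg _
    obtain ⟨s, hs, hs1⟩ := exists_between ((div_lt_one (by positivity)).2 (lt_one_add K))
    have hs0 : 0 < s := (by positivity : 0 ≤ K / (1 + K)).trans_lt hs
    rw [div_lt_iff₀ (by positivity)] at hs
    refine ⟨√s, Real.sqrt_pos.2 hs0, (Real.sqrt_lt' one_pos).2 (by rwa [one_pow]), ?_⟩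
    rw [Real.sq_sqrt hs0.le]
    linarith
  have norm_circle (θ : ℝ) : ‖ρ * Complex.exp (θ * Complex.I)‖ = ρ := by
    rw [norm_mul, Complex.norm_exp_ofReal_mul_I, mul_one, Complex.norm_real,
      Real.norm_of_nonneg hρ0.le]
  obtain ⟨x, hx, hx_coord⟩ := exists_continuous_rightInverse_diskCoord y
  let circle : ℝ → Metric.ball (0 : ℂ) 1 := fun θ =>
    ⟨ρ * Complex.exp (θ * Complex.I), mem_ball_zero_iff.2 ((norm_circle θ).trans_lt hρ1)⟩
  have circle_cont : Continuous circle := Continuous.subtype_mk (by fun_prop) _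
  have circle_loop : circle (2 * Real.pi) = circle 0 :=
    Subtype.ext (by simp [circle, Complex.exp_two_pi_mul_I])
  obtain ⟨z, hz⟩ := exists_eq_zero_of_norm_sub_lt ((continuous_diskCoord y).comp hf)
    (hx.comp circle_cont) (congrArg x circle_loop) (ρ := ρ) fun θ => by
      have := norm_diskCoord_sub_lt (y := y) (hC (x (circle θ))) (ρ := ρ)
        (by rw [hx_coord]; exact norm_circle θ) hρK
      rwa [hx_coord] at this
  exact ⟨z, diskCoord_eq_zero.1 hz⟩

/-! ### Hyperbolic barycenters -/

/-- In the hyperboloid model, where `cosh (dist q v)` is minus the Lorentz product of `q` and `v`,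
the point `q` lies on the ray through the vector which represents the linear form `S`. -/
def IsBarycenter (S : ℍ → ℝ) (q : ℍ) : Prop :=
  ∃ r > 0, ∀ v, r * Real.cosh (dist q v) = S v

theorem IsBarycenter.unique {S : ℍ → ℝ} {p q : ℍ} (hp : IsBarycenter S p)
    (hq : IsBarycenter S q) : p = q := by
  obtain ⟨r, hr, hpS⟩ := hp
  obtain ⟨s, hs, hqS⟩ := hq
  have at_p : r = s * Real.cosh (dist p q) := by
    simpa [dist_comm q p] using (hpS p).trans (hqS p).symm
  have at_q : r * Real.cosh (dist p q) = s := by simpa using (hpS q).trans (hqS q).symm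
  by_contra hne
  nlinarith [Real.one_lt_cosh.2 (dist_ne_zero.2 hne)]

theorem IsBarycenter.smul {G : Type*} [Group G] [MulAction G ℍ] [IsIsometricSMul G ℍ] (g : G)
    {S : ℍ → ℝ} {q : ℍ} (h : IsBarycenter S q) :
    IsBarycenter (fun v => S (g⁻¹ • v)) (g • q) := by
  obtain ⟨r, hr, h⟩ := h
  refine ⟨r, hr, fun v => ?_⟩
  simp only [← h (g⁻¹ • v), ← dist_smul g q, smul_inv_smul]

theorem isBarycenter_of_two_mul_im_mul_eq {S : ℍ → ℝ} {A B C : ℝ} (hA : 0 < A)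
    (hdisc : B ^ 2 < A * C)
    (hS : ∀ v : ℍ, 2 * v.im * S v = C - 2 * B * v.re + A * (v.re ^ 2 + v.im ^ 2)) {q : ℍ}
    (hre : q.re = B / A) (him : q.im = √(A * C - B ^ 2) / A) : IsBarycenter S q := by
  have disc_pos : 0 < A * C - B ^ 2 := sub_pos.2 hdisc
  refine ⟨√(A * C - B ^ 2), Real.sqrt_pos.2 disc_pos, fun v => ?_⟩
  apply mul_left_cancel₀ (mul_pos two_pos v.im_pos).ne'
  rw [mul_left_comm, two_mul_im_mul_cosh_dist, hS, hre, him]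
  have sq_root := Real.sq_sqrt disc_pos.le
  have := Real.sqrt_pos.2 disc_pos
  field_simp
  rw [sq_root]
  ring

theorem sq_sum_mul_re_lt {ι : Type*} [Fintype ι] {k : ι → ℝ} (hk : ∀ i, 0 ≤ k i)
    (hk_pos : 0 < ∑ i, k i) (w : ι → ℍ) :
    (∑ i, k i * (w i).re) ^ 2 < (∑ i, k i) * ∑ i, k i * ((w i).re ^ 2 + (w i).im ^ 2) := by
  obtain ⟨i, -, hi⟩ := Finset.exists_lt_of_sum_lt (s := Finset.univ) (f := fun _ => (0 : ℝ))
    (by simpa using hk_pos)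
  have cauchy_schwarz : (∑ i, k i * (w i).re) ^ 2 ≤ (∑ i, k i) * ∑ i, k i * (w i).re ^ 2 :=
    Finset.sum_sq_le_sum_mul_sum_of_sq_le_mul _ (fun i _ => hk i)
      (fun i _ => mul_nonneg (hk i) (sq_nonneg _)) fun i _ => le_of_eq (by ring)
  have sum_im_pos : 0 < ∑ i, k i * (w i).im ^ 2 :=
    Finset.sum_pos' (fun i _ => mul_nonneg (hk i) (sq_nonneg _))
      ⟨i, Finset.mem_univ i, mul_pos hi (pow_pos (w i).im_pos 2)⟩
  simp only [mul_add, Finset.sum_add_distrib]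
  linarith [mul_pos hk_pos sum_im_pos]

theorem exists_continuous_isBarycenter {X ι : Type*} [TopologicalSpace X] [Fintype ι]
    (w : ι → ℍ) {k : X → ι → ℝ} (hk : Continuous k) (hk_nonneg : ∀ t i, 0 ≤ k t i)
    (hk_pos : ∀ t, 0 < ∑ i, k t i) :
    ∃ F : X → ℍ, Continuous F ∧
      ∀ t, IsBarycenter (fun v => ∑ i, k t i * Real.cosh (dist (w i) v)) (F t) := by
  let n : X → ι → ℝ := fun t i => k t i / (w i).im
  have n_nonneg (t : X) (i : ι) : 0 ≤ n t i := div_nonneg (hk_nonneg t i) (w i).im_pos.le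
  have n_cont (i : ι) : Continuous fun t => n t i :=
    ((continuous_apply i).comp hk).div_const _
  let A : X → ℝ := fun t => ∑ i, n t i
  let B : X → ℝ := fun t => ∑ i, n t i * (w i).re
  let C : X → ℝ := fun t => ∑ i, n t i * ((w i).re ^ 2 + (w i).im ^ 2)
  have A_cont : Continuous A := continuous_finsetSum _ fun i _ => n_cont i
  have B_cont : Continuous B := continuous_finsetSum _ fun i _ => (n_cont i).mul_const _
  have C_cont : Continuous C := continuous_finsetSum _ fun i _ => (n_cont i).mul_const _
  have A_pos (t : X) : 0 < A t := by
    obtain ⟨i, -, hi⟩ := Finset.exists_lt_of_sum_lt (s := Finset.univ) (f := fun _ => (0 : ℝ))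
      (by simpa using hk_pos t)
    exact Finset.sum_pos' (fun i _ => n_nonneg t i)
      ⟨i, Finset.mem_univ i, div_pos hi (w i).im_pos⟩
  have disc_pos (t : X) : B t ^ 2 < A t * C t := sq_sum_mul_re_lt (n_nonneg t) (A_pos t) w
  have im_pos (t : X) : 0 < (⟨B t / A t, √(A t * C t - B t ^ 2) / A t⟩ : ℂ).im :=
    div_pos (Real.sqrt_pos.2 (sub_pos.2 (disc_pos t))) (A_pos t)
  refine ⟨fun t => ⟨_, im_pos t⟩, ?_, fun t => ?_⟩
  · refine Continuous.upperHalfPlaneMk (Complex.equivRealProdCLM.symm.continuous.comp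
      (f := fun t => (B t / A t, √(A t * C t - B t ^ 2) / A t)) ?_) im_pos
    exact (B_cont.div A_cont fun t => (A_pos t).ne').prodMk
      (((A_cont.mul C_cont).sub (B_cont.pow 2)).sqrt.div A_cont fun t => (A_pos t).ne')
  · refine isBarycenter_of_two_mul_im_mul_eq (A_pos t) (disc_pos t) (fun v => ?_) rfl rfl
    rw [Finset.mul_sum]
    simp only [mul_left_comm (2 * v.im), two_mul_im_mul_cosh_dist]
    simp only [A, B, C, n, Finset.mul_sum, Finset.sum_mul, ← Finset.sum_sub_distrib,
      ← Finset.sum_add_distrib]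
    exact Finset.sum_congr rfl fun i _ => by ring

end HyperbolicPlane

/-! ### Barycentric weights on a polygon -/

section PolygonWeight

open scoped ComplexConjugate

theorem polygonEdge_eq_exp (m j : ℕ) (t : ℝ) :
    polygonEdge m j t = Complex.exp ((2 * Real.pi * ((j + t) / m) : ℝ) * Complex.I) := by
  rw [polygonEdge]
  congr 1
  push_cast
  ring

theorem norm_polygonEdge (m j : ℕ) (t : ℝ) : ‖polygonEdge m j t‖ = 1 := by
  rw [polygonEdge_eq_exp, Complex.norm_exp_ofReal_mul_I]

theorem norm_ofReal_mul_polygonEdge {r : ℝ} (hr : 0 ≤ r) (m j : ℕ) (t : ℝ) :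
    ‖r * polygonEdge m j t‖ = r := by
  rw [norm_mul, norm_polygonEdge, mul_one, Complex.norm_real, Real.norm_of_nonneg hr]

theorem continuous_polygonEdge (m j : ℕ) : Continuous (polygonEdge m j) := by
  unfold polygonEdge
  fun_prop

theorem polygonEdge_one (m j : ℕ) : polygonEdge m j 1 = polygonEdge m (j + 1) 0 := by
  simp [polygonEdge]

theorem polygonEdge_self {m : ℕ} (hm : m ≠ 0) : polygonEdge m m 0 = polygonEdge m 0 0 := by
  simp [polygonEdge, hm, Complex.exp_two_pi_mul_I]

theorem exists_eq_norm_mul_polygonEdge {m : ℕ} (hm : 0 < m) (z : ℂ) :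
    ∃ j < m, ∃ t ∈ Set.Icc (0 : ℝ) 1, z = ‖z‖ * polygonEdge m j t := by
  have hm' : (0 : ℝ) < m := Nat.cast_pos.2 hm
  set θ := toIcoMod Real.two_pi_pos 0 z.arg with hθ
  obtain ⟨hθ0, hθ1⟩ : 0 ≤ θ ∧ θ < 2 * Real.pi := by
    simpa using toIcoMod_mem_Ico Real.two_pi_pos 0 z.arg
  have exp_θ : Complex.exp (θ * Complex.I) = Complex.exp (z.arg * Complex.I) := by
    rw [hθ, toIcoMod, Complex.exp_eq_exp_iff_exists_int]
    exact ⟨-toIcoDiv Real.two_pi_pos 0 z.arg, by push_cast [zsmul_eq_mul]; ring⟩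
  set s := m * (θ / (2 * Real.pi)) with hs
  have hs0 : 0 ≤ s := by positivity
  have hsm : s < m := mul_lt_of_lt_one_right hm' ((div_lt_one Real.two_pi_pos).2 hθ1)
  refine ⟨⌊s⌋₊, (Nat.floor_lt hs0).2 hsm, s - ⌊s⌋₊, ⟨sub_nonneg.2 (Nat.floor_le hs0), ?_⟩, ?_⟩
  · linarith [Nat.lt_floor_add_one s]
  · have angle : 2 * Real.pi * (s / m) = θ := by rw [hs]; field_simp
    rw [polygonEdge_eq_exp, add_sub_cancel, angle, exp_θ, Complex.norm_mul_exp_arg_mul_I]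

theorem re_ofReal_mul_polygonEdge_mul_conj (r : ℝ) (m j l : ℕ) (t : ℝ) :
    (r * polygonEdge m j t * conj (polygonEdge m l 0)).re =
      r * Real.cos (2 * Real.pi * ((j + t - l) / m)) := by
  have polygonEdge_mul_conj : polygonEdge m j t * conj (polygonEdge m l 0) =
      Complex.exp ((2 * Real.pi * ((j + t - l) / m) : ℝ) * Complex.I) := by
    rw [polygonEdge_eq_exp, polygonEdge_eq_exp, ← Complex.exp_conj, ← Complex.exp_add]
    simp only [map_mul, Complex.conj_ofReal, Complex.conj_I]
    push_cast
    ring_nf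
  rw [mul_assoc, polygonEdge_mul_conj, Complex.re_ofReal_mul, Complex.exp_ofReal_mul_I_re]

/-- The weight of the `l`-th vertex of the `m`-gon on the plane: a function which is homogeneous of
degree one and supported on the two sectors at this vertex. -/
def vertexWeight (m l : ℕ) (z : ℂ) : ℝ :=
  max 0 ((z * conj (polygonEdge m l 0)).re - ‖z‖ * Real.cos (2 * Real.pi / m))

/-- The weight of the initial vertex at the point with parameter `t` on an edge of the `m`-gon. -/
def edgeWeight (m : ℕ) (t : ℝ) : ℝ := Real.cos (2 * Real.pi * t / m) - Real.cos (2 * Real.pi / m)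

theorem continuous_vertexWeight (m l : ℕ) : Continuous (vertexWeight m l) := by
  unfold vertexWeight
  fun_prop

theorem vertexWeight_ofReal_mul_polygonEdge {r : ℝ} (hr : 0 ≤ r) (m l j : ℕ) (t : ℝ) :
    vertexWeight m l (r * polygonEdge m j t) =
      r * max 0 (Real.cos (2 * Real.pi * ((j + t - l) / m)) - Real.cos (2 * Real.pi / m)) := by
  rw [vertexWeight, re_ofReal_mul_polygonEdge_mul_conj, norm_ofReal_mul_polygonEdge hr, ← mul_sub,
    mul_max_of_nonneg _ _ hr, mul_zero]

theorem edgeWeight_pos {m : ℕ} (hm : 2 ≤ m) {t : ℝ} (ht : t ∈ Set.Ico (0 : ℝ) 1) :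
    0 < edgeWeight m t := by
  have hm' : (2 : ℝ) ≤ m := by exact_mod_cast hm
  have hπ := Real.pi_pos
  have ht0 := ht.1
  refine sub_pos.2 (Real.cos_lt_cos_of_nonneg_of_le_pi (by positivity) ?_ ?_)
  · rw [div_le_iff₀ (by positivity)]
    nlinarith
  · exact div_lt_div_of_pos_right (mul_lt_of_lt_one_right Real.two_pi_pos ht.2) (by positivity)

theorem edgeWeight_one (m : ℕ) : edgeWeight m 1 = 0 := by rw [edgeWeight, mul_one, sub_self]

theorem edgeWeight_nonneg {m : ℕ} (hm : 2 ≤ m) {t : ℝ} (ht : t ∈ Set.Icc (0 : ℝ) 1) :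
    0 ≤ edgeWeight m t := by
  rcases ht.2.eq_or_lt with rfl | ht1
  · exact (edgeWeight_one m).ge
  · exact (edgeWeight_pos hm ⟨ht.1, ht1⟩).le

theorem edgeWeight_add_pos {m : ℕ} (hm : 2 ≤ m) {t : ℝ} (ht : t ∈ Set.Icc (0 : ℝ) 1) :
    0 < edgeWeight m t + edgeWeight m (1 - t) := by
  have ht' : 1 - t ∈ Set.Icc (0 : ℝ) 1 := ⟨sub_nonneg.2 ht.2, sub_le_self _ ht.1⟩
  rcases ht.2.eq_or_lt with rfl | ht1
  · exact add_pos_of_nonneg_of_pos (edgeWeight_nonneg hm ht) (edgeWeight_pos hm (by simp))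
  · exact add_pos_of_pos_of_nonneg (edgeWeight_pos hm ⟨ht.1, ht1⟩) (edgeWeight_nonneg hm ht')

theorem cos_le_cos_of_le_of_le_two_pi_sub {a x : ℝ} (ha : 0 ≤ a) (hax : a ≤ x)
    (hxa : x ≤ 2 * Real.pi - a) : Real.cos x ≤ Real.cos a := by
  rcases le_total x Real.pi with h | h
  · exact Real.cos_le_cos_of_nonneg_of_le_pi ha h hax
  · rw [← Real.cos_two_pi_sub]
    exact Real.cos_le_cos_of_nonneg_of_le_pi ha (by linarith) (by linarith)

theorem cos_two_pi_mul_div_le {m : ℕ} {x : ℝ} (hx : 1 ≤ |x|) (hxm : |x| ≤ m - 1) :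
    Real.cos (2 * Real.pi * (x / m)) ≤ Real.cos (2 * Real.pi / m) := by
  have hm : (0 : ℝ) < m := by linarith
  have hπ := Real.two_pi_pos
  rw [← Real.cos_abs (2 * Real.pi * (x / m)), abs_mul, abs_div, Nat.abs_cast, abs_of_pos hπ,
    ← mul_div_assoc]
  refine cos_le_cos_of_le_of_le_two_pi_sub (by positivity) ?_ ?_
  · exact div_le_div_of_nonneg_right (le_mul_of_one_le_right hπ.le hx) hm.le
  · rw [le_sub_iff_add_le, ← add_div, div_le_iff₀ hm]
    nlinarith

theorem vertexWeight_left {m j : ℕ} (hm : 2 ≤ m) {r t : ℝ} (hr : 0 ≤ r)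
    (ht : t ∈ Set.Icc (0 : ℝ) 1) :
    vertexWeight m j (r * polygonEdge m j t) = r * edgeWeight m t := by
  rw [vertexWeight_ofReal_mul_polygonEdge hr, add_sub_cancel_left, ← mul_div_assoc, ← edgeWeight,
    max_eq_right (edgeWeight_nonneg hm ht)]

theorem vertexWeight_right {m j : ℕ} (hm : 2 ≤ m) (hj : j < m) {r t : ℝ} (hr : 0 ≤ r)
    (ht : t ∈ Set.Icc (0 : ℝ) 1) :
    vertexWeight m ((j + 1) % m) (r * polygonEdge m j t) = r * edgeWeight m (1 - t) := by
  have ht' : 1 - t ∈ Set.Icc (0 : ℝ) 1 := ⟨sub_nonneg.2 ht.2, sub_le_self _ ht.1⟩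
  have hm0 : (m : ℝ) ≠ 0 := by positivity
  have cos_eq : Real.cos (2 * Real.pi * ((j + t - ((j + 1) % m : ℕ)) / m)) =
      Real.cos (2 * Real.pi * (1 - t) / m) := by
    rcases (Nat.succ_le_of_lt hj).eq_or_lt with rfl | h
    · rw [Nat.succ_eq_add_one, Nat.mod_self, ← Real.cos_two_pi_sub]
      congr 1
      push_cast at hm0 ⊢
      field_simp
      ring
    · rw [Nat.mod_eq_of_lt h, ← Real.cos_neg]
      congr 1
      push_cast
      ring
  rw [vertexWeight_ofReal_mul_polygonEdge hr, cos_eq, ← edgeWeight,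
    max_eq_right (edgeWeight_nonneg hm ht')]

theorem vertexWeight_eq_zero {m l j : ℕ} (hl : l < m) (hj : j < m) (hlj : l ≠ j)
    (hlj' : l ≠ (j + 1) % m) {r t : ℝ} (hr : 0 ≤ r) (ht : t ∈ Set.Icc (0 : ℝ) 1) :
    vertexWeight m l (r * polygonEdge m j t) = 0 := by
  obtain ⟨ht0, ht1⟩ := ht
  have far : 1 ≤ |j + t - l| ∧ |j + t - l| ≤ m - 1 := by
    rcases hlj.lt_or_gt with h | h
    · have hl0 : (l : ℝ) + 1 ≤ j := by exact_mod_cast h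
      have hjl : (j : ℝ) + 2 ≤ m + l := by
        have : j + 1 ≠ m ∨ 0 < l := by
          by_contra! h0
          exact hlj' (by rw [h0.1, Nat.mod_self]; omega)
        exact_mod_cast (by omega : j + 2 ≤ m + l)
      rw [abs_of_nonneg (by linarith)]
      constructor <;> linarith
    · have hjl : (j : ℝ) + 2 ≤ l := by
        rw [Nat.mod_eq_of_lt (by omega)] at hlj'
        exact_mod_cast (by omega : j + 2 ≤ l)
      have hlm : (l : ℝ) + 1 ≤ m := by exact_mod_cast hl
      rw [abs_of_nonpos (by linarith)]
      constructor <;> linarith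
  rw [vertexWeight_ofReal_mul_polygonEdge hr,
    max_eq_left (sub_nonpos.2 (cos_two_pi_mul_div_le far.1 far.2)), mul_zero]

theorem sum_vertexWeight_mul {m j : ℕ} (hm : 2 ≤ m) (hj : j < m) {r t : ℝ} (hr : 0 ≤ r)
    (ht : t ∈ Set.Icc (0 : ℝ) 1) {a : ℕ → ℝ} (ha : a m = a 0) :
    ∑ l ∈ Finset.range m, vertexWeight m l (r * polygonEdge m j t) * a l =
      r * (edgeWeight m t * a j + edgeWeight m (1 - t) * a (j + 1)) := by
  obtain ⟨ne_mod, a_mod⟩ : j ≠ (j + 1) % m ∧ a ((j + 1) % m) = a (j + 1) := by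
    rcases (Nat.succ_le_of_lt hj).eq_or_lt with rfl | h
    · rw [Nat.succ_eq_add_one, Nat.mod_self, ha]
      exact ⟨by omega, rfl⟩
    · rw [Nat.mod_eq_of_lt h]
      exact ⟨by omega, rfl⟩
  have subset : {j, (j + 1) % m} ⊆ Finset.range m := by
    simp [Finset.insert_subset_iff, hj, Nat.mod_lt (j + 1) (by omega : 0 < m)]
  rw [← Finset.sum_subset subset, Finset.sum_pair ne_mod, a_mod, vertexWeight_left hm hr ht,
    vertexWeight_right hm hj hr ht]
  · ring
  · intro l hl hl'
    simp only [Finset.mem_insert, Finset.mem_singleton, not_or] at hl'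
    rw [vertexWeight_eq_zero (Finset.mem_range.1 hl) hj hl'.1 hl'.2 hr ht, zero_mul]

/-- Weights on the unit disk, viewed as an `m`-gon which is the cone, with apex at the zeroth
vertex, over its boundary. -/
def polygonWeight (m : ℕ) (z : ℂ) (l : Fin m) : ℝ :=
  vertexWeight m l z + if (l : ℕ) = 0 then 1 - ‖z‖ else 0

theorem continuous_polygonWeight (m : ℕ) : Continuous (polygonWeight m) := by
  refine continuous_pi fun l => (continuous_vertexWeight m l).add ?_
  split_ifs <;> fun_prop

theorem polygonWeight_nonneg {m : ℕ} {z : ℂ} (hz : ‖z‖ ≤ 1) (l : Fin m) :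
    0 ≤ polygonWeight m z l := by
  refine add_nonneg (le_max_left _ _) ?_
  split_ifs
  exacts [sub_nonneg.2 hz, le_rfl]

theorem sum_polygonWeight_mul {m j : ℕ} (hm : 2 ≤ m) (hj : j < m) {r t : ℝ} (hr : 0 ≤ r)
    (ht : t ∈ Set.Icc (0 : ℝ) 1) {a : ℕ → ℝ} (ha : a m = a 0) :
    ∑ l : Fin m, polygonWeight m (r * polygonEdge m j t) l * a l =
      (1 - r) * a 0 + r * (edgeWeight m t * a j + edgeWeight m (1 - t) * a (j + 1)) := by
  have apex : ∑ l ∈ Finset.range m, (if l = 0 then 1 - r else 0) * a l = (1 - r) * a 0 := by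
    simp only [ite_mul, zero_mul]
    rw [Finset.sum_ite_eq' _ 0 (fun l => (1 - r) * a l), if_pos (Finset.mem_range.2 (by omega))]
  simp only [polygonWeight, add_mul, Finset.sum_add_distrib, norm_ofReal_mul_polygonEdge hr]
  rw [Fin.sum_univ_eq_sum_range (fun l => vertexWeight m l (r * polygonEdge m j t) * a l),
    Fin.sum_univ_eq_sum_range (fun l => (if l = 0 then 1 - r else 0) * a l), apex,
    sum_vertexWeight_mul hm hj hr ht ha, add_comm]

theorem sum_polygonWeight_pos {m : ℕ} (hm : 2 ≤ m) {z : ℂ} (hz : ‖z‖ ≤ 1) :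
    0 < ∑ l : Fin m, polygonWeight m z l := by
  obtain ⟨j, hj, t, ht, hz_eq⟩ := exists_eq_norm_mul_polygonEdge (by omega : 0 < m) z
  have sum_eq := sum_polygonWeight_mul hm hj (norm_nonneg z) ht (a := fun _ => 1) rfl
  simp only [← hz_eq, mul_one] at sum_eq
  rw [sum_eq]
  rcases hz.eq_or_lt with h | h
  · simpa [h] using edgeWeight_add_pos hm ht
  · exact add_pos_of_pos_of_nonneg (sub_pos.2 h)
      (mul_nonneg (norm_nonneg z) (edgeWeight_add_pos hm ht).le)

end PolygonWeight

/-! ### The covering projection of an orbit space -/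

namespace OrbitSpace

variable {G X : Type*} [Group G] [MulAction G X]

theorem proj_eq_proj_iff {x y : X} : proj G x = proj G y ↔ ∃ g : G, g • y = x :=
  Quotient.eq''

theorem proj_smul (g : G) (x : X) : proj G (g • x) = proj G x :=
  proj_eq_proj_iff.2 ⟨g, rfl⟩

theorem proj_surjective : Function.Surjective (proj G : X → OrbitSpace G X) :=
  Quotient.mk_surjective

variable [TopologicalSpace X]

theorem continuous_proj : Continuous (proj G : X → OrbitSpace G X) :=
  continuous_quotient_mk'

variable [ContinuousConstSMul G X] [ProperlyDiscontinuousSMul G X] [LocallyCompactSpace X]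
  [T2Space X] [IsCancelSMul G X]

theorem isQuotientCoveringMap_proj : IsQuotientCoveringMap (proj G : X → OrbitSpace G X) G :=
  isQuotientCoveringMap_quotientMk_of_properlyDiscontinuousSMul

theorem isCoveringMap_proj : IsCoveringMap (proj G : X → OrbitSpace G X) :=
  isQuotientCoveringMap_proj.isCoveringMap

theorem eq_smul_of_proj_comp_eq {Y : Type*} [TopologicalSpace Y] [PreconnectedSpace Y]
    {a b : Y → X} (ha : Continuous a) (hb : Continuous b)
    (hab : ∀ y, proj G (b y) = proj G (a y)) {g : G} {y₀ : Y} (h : b y₀ = g • a y₀) (y : Y) :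
    b y = g • a y := by
  refine congrFun ((isCoveringMap_proj (G := G)).eq_of_comp_eq hb (ha.const_smul g) ?_ y₀ h) y
  ext z
  simp only [Function.comp_apply, Pi.smul_apply, proj_smul, hab]

theorem exists_continuousMap_lift {Y : Type*} [TopologicalSpace Y] [SimplyConnectedSpace Y]
    [LocallyPathConnectedSpace Y] (f : C(Y, OrbitSpace G X)) :
    ∃ F : C(Y, X), ∀ y, proj G (F y) = f y := by
  obtain ⟨y₀⟩ : Nonempty Y := inferInstance
  obtain ⟨x₀, hx₀⟩ := proj_surjective (f y₀)
  obtain ⟨F, ⟨-, hF⟩, -⟩ := isCoveringMap_proj.existsUnique_continuousMap_lifts f y₀ x₀ hx₀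
  exact ⟨F, congrFun hF⟩

end OrbitSpace

/-! ### Straightening a polygon -/

open HyperbolicPlane

section Extension

variable {G X Y P : Type*} [Group G] [MulAction G X] [MulAction G Y]

theorem exists_equivariant_extension {p : P → X} (hp : ∀ x, ∃ (g : G) (z : P), x = g • p z)
    {f : P → Y} (hf : ∀ (g : G) (y z : P), p z = g • p y → f z = g • f y) :
    ∃ F : X → Y, (∀ z, F (p z) = f z) ∧ ∀ (g : G) (x : X), F (g • x) = g • F x := by
  choose d z hdz using hp
  have smul_p (g : G) (y : P) : d (g • p y) • f (z (g • p y)) = g • f y := by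
    rw [hf ((d (g • p y))⁻¹ * g) y, smul_smul, mul_inv_cancel_left]
    rw [mul_smul, eq_inv_smul_iff, ← hdz]
  refine ⟨fun x => d x • f (z x), fun y => ?_, fun g x => ?_⟩
  · simpa using smul_p 1 y
  · obtain ⟨h, y, rfl⟩ : ∃ (h : G) (y : P), x = h • p y := ⟨d x, z x, hdz x⟩
    simp only [smul_smul g, smul_p]

theorem continuous_of_continuous_comp_of_equivariant [TopologicalSpace X] [T2Space X]
    [LocallyCompactSpace X] [ContinuousConstSMul G X] [ProperlyDiscontinuousSMul G X]
    [TopologicalSpace Y] [ContinuousConstSMul G Y] [TopologicalSpace P] [CompactSpace P]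
    {p : P → X} (hp : Continuous p) (hcov : ∀ x, ∃ (g : G) (z : P), x = g • p z) {f : X → Y}
    (hf : Continuous (f ∘ p)) (hequiv : ∀ (g : G) (x : X), f (g • x) = g • f x) :
    Continuous f := by
  have range_compact : IsCompact (Set.range p) := isCompact_range hp
  have locallyFinite : LocallyFinite fun g : G => g • Set.range p := fun x => by
    obtain ⟨L, hL, hxL⟩ := exists_compact_mem_nhds x
    exact ⟨L, hxL, ProperlyDiscontinuousSMul.finite_disjoint_inter_image range_compact hL⟩
  have f_range : ContinuousOn f (Set.range p) := by
    have quotient_p : Topology.IsQuotientMap (Set.rangeFactorization p) :=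
      (hp.subtype_mk _).isClosedMap.isQuotientMap (hp.subtype_mk _)
        Set.rangeFactorization_surjective
    rwa [continuousOn_iff_continuous_domRestrict, quotient_p.continuous_iff]
  refine locallyFinite.continuous ?_ (fun g => range_compact.isClosed.smul g) fun g => ?_
  · refine Set.eq_univ_of_forall fun x => ?_
    obtain ⟨g, z, rfl⟩ := hcov x
    exact Set.mem_iUnion.2 ⟨g, Set.smul_mem_smul_set ⟨z, rfl⟩⟩
  · have f_eq : f = fun x => g • f (g⁻¹ • x) := by
      ext x
      rw [hequiv, smul_inv_smul]
    rw [f_eq]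
    exact (f_range.comp (continuous_const_smul g⁻¹).continuousOn
      fun x hx => Set.mem_smul_set_iff_inv_smul_mem.1 hx).const_smul g

end Extension

/-- The closed unit disk, as a polygon with curved edges. -/
abbrev UnitDisk : Type := Metric.closedBall (0 : ℂ) 1

instance : SimplyConnectedSpace UnitDisk :=
  have : ContractibleSpace UnitDisk := (convex_closedBall (0 : ℂ) 1).contractibleSpace ⟨0, by simp⟩
  inferInstance

instance : LocallyPathConnectedSpace UnitDisk :=
  (convex_closedBall (0 : ℂ) 1).locallyPathConnectedSpace

/-- The point with parameter `t` on the `j`-th edge, as a point of the unit disk. -/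
def edgePoint (m j : ℕ) (t : ℝ) : UnitDisk :=
  ⟨polygonEdge m j t, by simp [norm_polygonEdge]⟩

theorem continuous_edgePoint (m j : ℕ) : Continuous (edgePoint m j) :=
  (continuous_polygonEdge m j).subtype_mk _

theorem edgePoint_one (m j : ℕ) : edgePoint m j 1 = edgePoint m (j + 1) 0 :=
  Subtype.ext (polygonEdge_one m j)

theorem edgePoint_self {m : ℕ} (hm : m ≠ 0) : edgePoint m m 0 = edgePoint m 0 0 :=
  Subtype.ext (polygonEdge_self hm)

/-- The map `P` sends the disk onto a geodesic polygon with vertices `w 0, …, w (m - 1)`: the image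
of a point is the barycenter of the vertices with the weights `polygonWeight`. -/
structure IsStraightPolygon (m : ℕ) (w : ℕ → ℍ) (P : UnitDisk → ℍ) : Prop where
  two_le : 2 ≤ m
  vertex_self : w m = w 0
  continuous : Continuous P
  isBarycenter : ∀ z : UnitDisk, IsBarycenter
    (fun v => ∑ l : Fin m, polygonWeight m z l * Real.cosh (dist (w l) v)) (P z)

theorem exists_isStraightPolygon {m : ℕ} (hm : 2 ≤ m) {w : ℕ → ℍ} (hw : w m = w 0) :
    ∃ P, IsStraightPolygon m w P := by
  have norm_le (z : UnitDisk) : ‖(z : ℂ)‖ ≤ 1 := mem_closedBall_zero_iff.1 z.2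
  obtain ⟨P, hP, hPw⟩ := exists_continuous_isBarycenter (X := UnitDisk) (fun l : Fin m => w l)
    (k := fun z => polygonWeight m z) ((continuous_polygonWeight m).comp continuous_subtype_val)
    (fun z => polygonWeight_nonneg (norm_le z)) (fun z => sum_polygonWeight_pos hm (norm_le z))
  exact ⟨P, hm, hw, hP, hPw⟩

namespace IsStraightPolygon

variable {m : ℕ} {w : ℕ → ℍ} {P : UnitDisk → ℍ}

theorem isBarycenter_of_eq (hP : IsStraightPolygon m w P) {j : ℕ} (hj : j < m) {r t : ℝ}
    (hr : 0 ≤ r) (ht : t ∈ Set.Icc (0 : ℝ) 1) {z : UnitDisk}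
    (hz : (z : ℂ) = r * polygonEdge m j t) :
    IsBarycenter (fun v => (1 - r) * Real.cosh (dist (w 0) v) +
      r * (edgeWeight m t * Real.cosh (dist (w j) v) +
        edgeWeight m (1 - t) * Real.cosh (dist (w (j + 1)) v))) (P z) := by
  have sum_eq (v : ℍ) := sum_polygonWeight_mul hP.two_le hj hr ht
    (a := fun l => Real.cosh (dist (w l) v)) (by rw [hP.vertex_self])
  simpa only [hz, sum_eq] using hP.isBarycenter z

theorem isBarycenter_edgePoint (hP : IsStraightPolygon m w P) {j : ℕ} (hj : j < m) {t : ℝ}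
    (ht : t ∈ Set.Icc (0 : ℝ) 1) :
    IsBarycenter (fun v => edgeWeight m t * Real.cosh (dist (w j) v) +
      edgeWeight m (1 - t) * Real.cosh (dist (w (j + 1)) v)) (P (edgePoint m j t)) := by
  simpa using hP.isBarycenter_of_eq hj zero_le_one ht (z := edgePoint m j t) (by simp [edgePoint])

theorem exists_mem_geodesicTriangle (hP : IsStraightPolygon m w P) (z : UnitDisk) :
    ∃ j < m, P z ∈ geodesicTriangle (w 0) (w j) (w (j + 1)) := by
  obtain ⟨j, hj, t, ht, hz⟩ := exists_eq_norm_mul_polygonEdge (two_pos.trans_le hP.two_le) (z : ℂ)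
  have ht' : 1 - t ∈ Set.Icc (0 : ℝ) 1 := ⟨sub_nonneg.2 ht.2, sub_le_self _ ht.1⟩
  obtain ⟨s, hs, h⟩ := hP.isBarycenter_of_eq hj (norm_nonneg _) ht hz
  refine ⟨j, hj, (1 - ‖(z : ℂ)‖) / s, ‖(z : ℂ)‖ * edgeWeight m t / s,
    ‖(z : ℂ)‖ * edgeWeight m (1 - t) / s,
    div_nonneg (sub_nonneg.2 (mem_closedBall_zero_iff.1 z.2)) hs.le,
    div_nonneg (mul_nonneg (norm_nonneg _) (edgeWeight_nonneg hP.two_le ht)) hs.le,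
    div_nonneg (mul_nonneg (norm_nonneg _) (edgeWeight_nonneg hP.two_le ht')) hs.le, fun v => ?_⟩
  apply mul_left_cancel₀ hs.ne'
  rw [h v]
  field_simp
  ring

variable {G : Type*} [Group G] [MulAction G ℍ] [IsIsometricSMul G ℍ]

theorem smul_edgePoint (hP : IsStraightPolygon m w P) {i j : ℕ} (hi : i < m) (hj : j < m) {g : G}
    (h₀ : w j = g • w i) (h₁ : w (j + 1) = g • w (i + 1)) {t : ℝ} (ht : t ∈ Set.Icc (0 : ℝ) 1) :
    P (edgePoint m j t) = g • P (edgePoint m i t) := by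
  refine (hP.isBarycenter_edgePoint hj ht).unique ?_
  simpa only [← dist_smul g _ (g⁻¹ • _), smul_inv_smul, ← h₀, ← h₁] using
    (hP.isBarycenter_edgePoint hi ht).smul g

theorem smul_edgePoint_symm (hP : IsStraightPolygon m w P) {i j : ℕ} (hi : i < m) (hj : j < m)
    {g : G} (h₀ : w (j + 1) = g • w i) (h₁ : w j = g • w (i + 1)) {t : ℝ}
    (ht : t ∈ Set.Icc (0 : ℝ) 1) :
    P (edgePoint m j (1 - t)) = g • P (edgePoint m i t) := by
  have ht' : 1 - t ∈ Set.Icc (0 : ℝ) 1 := ⟨sub_nonneg.2 ht.2, sub_le_self _ ht.1⟩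
  refine (hP.isBarycenter_edgePoint hj ht').unique ?_
  simpa only [← dist_smul g _ (g⁻¹ • _), smul_inv_smul, ← h₀, ← h₁, sub_sub_cancel, add_comm] using
    (hP.isBarycenter_edgePoint hi ht).smul g

end IsStraightPolygon

/-- The relation `R` identifies edges of the `m`-gon in pairs, either preserving the parameter or
reversing it. -/
def IsEdgeGluing (m : ℕ) (R : UnitDisk → UnitDisk → Prop) : Prop :=
  ∀ x y, R x y → ∃ i < m, ∃ j < m, ∃ t ∈ Set.Icc (0 : ℝ) 1,
    (x = edgePoint m i t ∧ y = edgePoint m j t ∧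
      ∀ s ∈ Set.Icc (0 : ℝ) 1, R (edgePoint m i s) (edgePoint m j s)) ∨
    (x = edgePoint m i t ∧ y = edgePoint m j (1 - t) ∧
      ∀ s ∈ Set.Icc (0 : ℝ) 1, R (edgePoint m i s) (edgePoint m j (1 - s)))

section Gluing

variable {G : Type*} [Group G] [MulAction G ℍ] [IsIsometricSMul G ℍ]
  [ProperlyDiscontinuousSMul G ℍ] [IsCancelSMul G ℍ]

theorem smul_eq_of_proj_eq_on_unitInterval {a b : ℝ → ℍ} (ha : Continuous a) (hb : Continuous b)
    (hab : ∀ s ∈ Set.Icc (0 : ℝ) 1, OrbitSpace.proj G (a s) = OrbitSpace.proj G (b s)) {t : ℝ}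
    (ht : t ∈ Set.Icc (0 : ℝ) 1) {g : G} (h : b t = g • a t) {s : ℝ} (hs : s ∈ Set.Icc (0 : ℝ) 1) :
    b s = g • a s :=
  OrbitSpace.eq_smul_of_proj_comp_eq (Y := unitInterval) (ha.comp continuous_subtype_val)
    (hb.comp continuous_subtype_val) (fun y => (hab y y.2).symm) (y₀ := ⟨t, ht⟩) h ⟨s, hs⟩

variable {m : ℕ} {R : UnitDisk → UnitDisk → Prop} {p P : UnitDisk → ℍ}

theorem IsEdgeGluing.exists_smul_eq (hR : IsEdgeGluing m R) (hp : Continuous p)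
    (hpR : ∀ x y, R x y → OrbitSpace.proj G (p x) = OrbitSpace.proj G (p y))
    (hP : IsStraightPolygon m (fun j => p (edgePoint m j 0)) P) {x y : UnitDisk} (hxy : R x y) :
    ∃ g : G, p y = g • p x ∧ P y = g • P x := by
  obtain ⟨g, hg⟩ := OrbitSpace.proj_eq_proj_iff.1 (hpR x y hxy).symm
  refine ⟨g, hg.symm, ?_⟩
  have h0 : (0 : ℝ) ∈ Set.Icc (0 : ℝ) 1 := ⟨le_rfl, zero_le_one⟩
  have h1 : (1 : ℝ) ∈ Set.Icc (0 : ℝ) 1 := ⟨zero_le_one, le_rfl⟩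
  obtain ⟨i, hi, j, hj, t, ht, ⟨rfl, rfl, hR⟩ | ⟨rfl, rfl, hR⟩⟩ := hR x y hxy
  · have p_edge {s : ℝ} := smul_eq_of_proj_eq_on_unitInterval (hp.comp (continuous_edgePoint m i))
      (hp.comp (continuous_edgePoint m j)) (fun s hs => hpR _ _ (hR s hs)) ht hg.symm (s := s)
    refine hP.smul_edgePoint hi hj (p_edge h0) ?_ ht
    simpa only [Function.comp_apply, edgePoint_one] using p_edge h1
  · have p_edge {s : ℝ} := smul_eq_of_proj_eq_on_unitInterval (hp.comp (continuous_edgePoint m i))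
      (hp.comp ((continuous_edgePoint m j).comp (continuous_const.sub continuous_id)))
      (fun s hs => hpR _ _ (hR s hs)) ht hg.symm (s := s)
    refine hP.smul_edgePoint_symm hi hj ?_ ?_ ht
    · simpa [edgePoint_one] using p_edge h0
    · simpa [edgePoint_one] using p_edge h1

theorem IsEdgeGluing.smul_eq_of_eqvGen (hR : IsEdgeGluing m R) (hp : Continuous p)
    (hpR : ∀ x y, R x y → OrbitSpace.proj G (p x) = OrbitSpace.proj G (p y))
    (hP : IsStraightPolygon m (fun j => p (edgePoint m j 0)) P) {x y : UnitDisk}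
    (hxy : Relation.EqvGen R x y) {g : G} (hg : p y = g • p x) : P y = g • P x := by
  let pP (z : UnitDisk) : OrbitSpace G (ℍ × ℍ) := OrbitSpace.proj G (p z, P z)
  have pP_eq : pP x = pP y := congrArg (Quot.lift pP fun a b hab => by
    obtain ⟨g, hpg, hPg⟩ := hR.exists_smul_eq hp hpR hP hab
    exact (OrbitSpace.proj_eq_proj_iff.2 ⟨g, Prod.ext hpg.symm hPg.symm⟩).symm)
    (Quot.eqvGen_sound hxy)
  obtain ⟨h, hh⟩ := OrbitSpace.proj_eq_proj_iff.1 pP_eq.symm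
  obtain ⟨hp_eq, hP_eq⟩ := Prod.ext_iff.1 hh
  obtain rfl : h = g := IsCancelSMul.right_cancel _ _ _ (hp_eq.trans hg)
  exact hP_eq.symm

theorem IsEdgeGluing.exists_triangles_cover (hm : 2 ≤ m) (hR : IsEdgeGluing m R)
    (e : Quot R ≃ₜ OrbitSpace G ℍ) :
    ∃ (w : ℕ → ℍ) (K : Set ℍ), IsCompact K ∧ w m = w 0 ∧ ∀ x : ℍ, ∃ g : G, g • x ∈ K ∧
      ∃ j < m, g • x ∈ geodesicTriangle (w 0) (w j) (w (j + 1)) := by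
  obtain ⟨p, hp⟩ := OrbitSpace.exists_continuousMap_lift
    (⟨fun z => e (Quot.mk R z), e.continuous.comp continuous_quot_mk⟩ :
      C(UnitDisk, OrbitSpace G ℍ))
  have proj_p_eq_iff (y z : UnitDisk) :
      OrbitSpace.proj G (p y) = OrbitSpace.proj G (p z) ↔ Relation.EqvGen R y z := by
    rw [hp, hp, ← Quot.eq]
    exact e.injective.eq_iff
  have p_cov (x : ℍ) : ∃ (g : G) (z : UnitDisk), x = g • p z := by
    obtain ⟨z, hz⟩ := (e.surjective.comp Quot.mk_surjective) (OrbitSpace.proj G x)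
    obtain ⟨g, hg⟩ := OrbitSpace.proj_eq_proj_iff.1 (hz.symm.trans (hp z).symm)
    exact ⟨g, z, hg.symm⟩
  have w_self : p (edgePoint m m 0) = p (edgePoint m 0 0) := by rw [edgePoint_self (by omega)]
  obtain ⟨P, hP⟩ := exists_isStraightPolygon hm (w := fun j => p (edgePoint m j 0)) w_self
  obtain ⟨f, hfp, hf⟩ := exists_equivariant_extension p_cov (f := P) fun g y z hg =>
    hR.smul_eq_of_eqvGen p.continuous (fun a b hab => (proj_p_eq_iff a b).2 (.rel _ _ hab)) hP
      ((proj_p_eq_iff y z).1 (by rw [hg, OrbitSpace.proj_smul])) hg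
  have f_cont : Continuous f := continuous_of_continuous_comp_of_equivariant p.continuous p_cov
    (by simpa only [Function.comp_def, hfp] using hP.continuous) hf
  have f_surj : Function.Surjective f := by
    obtain ⟨C, hC⟩ := (isCompact_range (hP.continuous.dist p.continuous)).bddAbove
    refine surjective_of_dist_le f_cont (C := C) fun x => ?_
    obtain ⟨g, z, rfl⟩ := p_cov x
    rw [hf, hfp, dist_smul]
    exact hC ⟨z, rfl⟩
  refine ⟨fun j => p (edgePoint m j 0), Set.range P, isCompact_range hP.continuous, w_self,
    fun x => ?_⟩
  obtain ⟨y, rfl⟩ := f_surj x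
  obtain ⟨g, z, rfl⟩ := p_cov y
  have inv_smul_f : g⁻¹ • f (g • p z) = P z := by rw [hf, hfp, inv_smul_smul]
  exact ⟨g⁻¹, inv_smul_f ▸ ⟨z, rfl⟩, inv_smul_f ▸ hP.exists_mem_geodesicTriangle z⟩

end Gluing

/-! ### Embedded disks in closed hyperbolic surfaces -/

section EmbeddedDisk

theorem sum_measure_inter_preimage_smul_le {G α : Type*} [Group G] [MulAction G α]
    [MeasurableSpace α] [MeasurableConstSMul G α] {μ : Measure α} [SMulInvariantMeasure G α μ]
    {U : Set α} (hU : MeasurableSet U) (hU_disj : ∀ g : G, g ≠ 1 → Disjoint (g • U) U)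
    (T : Set α) (F : Finset G) :
    ∑ g ∈ F, μ (U ∩ (g • ·) ⁻¹' T) ≤ μ T := by
  have measure_eq (g : G) : μ (U ∩ (g • ·) ⁻¹' T) = μ.restrict T (g • U) := by
    rw [Measure.restrict_apply (hU.const_smul g), ← measure_smul μ g, Set.smul_set_inter,
      Set.preimage_smul, smul_inv_smul]
  have pairwiseDisjoint : (F : Set G).PairwiseDisjoint fun g => g • U := fun g _ h _ hne => by
    have := hU_disj (h⁻¹ * g) (by rwa [Ne, inv_mul_eq_one, eq_comm])
    rwa [mul_smul, Set.disjoint_smul_set_left, inv_inv] at this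
  simp only [measure_eq]
  rw [← measure_biUnion_finset pairwiseDisjoint fun g _ => hU.const_smul g]
  exact (measure_mono (Set.subset_univ _)).trans_eq (Measure.restrict_apply_univ T)

variable {G : Type*} [Group G] [MulAction G ℍ] [IsIsometricSMul G ℍ]

instance : SMulInvariantMeasure G ℍ volume :=
  ⟨fun g s _ => HyperbolicPlane.volume_preimage_of_isometry (isometry_smul ℍ g) s⟩

variable [ProperlyDiscontinuousSMul G ℍ] [IsCancelSMul G ℍ] {r : ℝ}

theorem IsEdgeGluing.volume_ball_le {m : ℕ} (hm : 2 ≤ m) {R : UnitDisk → UnitDisk → Prop}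
    (hR : IsEdgeGluing m R) (e : OrbitSpace G ℍ ≃ₜ Quot R) {x : ℍ}
    (hdisj : ∀ g : G, g ≠ 1 → Disjoint (g • Metric.ball x r) (Metric.ball x r)) :
    volume (Metric.ball x r) ≤ ENNReal.ofReal ((m - 2) * Real.pi) := by
  obtain ⟨w, K, hK, hw, hcov⟩ := hR.exists_triangles_cover hm e.symm
  let F : Finset G := (ProperlyDiscontinuousSMul.finite_disjoint_inter_image (Γ := G)
    (isCompact_closedBall x r) hK).toFinset
  let T (j : ℕ) : Set ℍ := HyperbolicPlane.geodesicTriangle (w 0) (w j) (w (j + 1))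
  have subset : Metric.ball x r ⊆ ⋃ j ∈ Finset.range m, ⋃ g ∈ F,
      Metric.ball x r ∩ (g • ·) ⁻¹' T j := fun y hy => by
    obtain ⟨g, hgK, j, hj, hgT⟩ := hcov y
    have hg : g ∈ F := (Set.Finite.mem_toFinset _).2
      ⟨g • y, ⟨y, Metric.ball_subset_closedBall hy, rfl⟩, hgK⟩
    simp only [Set.mem_iUnion]
    exact ⟨j, Finset.mem_range.2 hj, g, hg, hy, hgT⟩
  calc volume (Metric.ball x r)
      ≤ ∑ j ∈ Finset.range m, volume (⋃ g ∈ F, Metric.ball x r ∩ (g • ·) ⁻¹' T j) :=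
        (measure_mono subset).trans (measure_biUnion_finset_le _ _)
    _ ≤ ∑ j ∈ Finset.range m, volume (T j) := Finset.sum_le_sum fun j _ =>
        (measure_biUnion_finset_le _ _).trans
          (sum_measure_inter_preimage_smul_le measurableSet_ball hdisj (T j) F)
    _ ≤ ENNReal.ofReal ((m - 2) * Real.pi) :=
        HyperbolicPlane.sum_volume_geodesicTriangle_le hm hw

theorem IsEdgeGluing.two_mul_cosh_le {m : ℕ} (hm : 2 ≤ m) {R : UnitDisk → UnitDisk → Prop}
    (hR : IsEdgeGluing m R) (e : OrbitSpace G ℍ ≃ₜ Quot R) {x : ℍ} (hr : 0 < r)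
    (hdisj : ∀ g : G, g ≠ 1 → Disjoint (g • Metric.ball x r) (Metric.ball x r)) :
    2 * Real.cosh r ≤ m := by
  have area_le := (HyperbolicPlane.le_volume_ball x hr).trans (hR.volume_ball_le hm e hdisj)
  have hm' : (2 : ℝ) ≤ m := by exact_mod_cast hm
  rw [ENNReal.ofReal_le_ofReal_iff (mul_nonneg (sub_nonneg.2 hm') Real.pi_pos.le)] at area_le
  nlinarith [Real.pi_pos]

theorem isEdgeGluing_orientableGluing (n : ℕ) : IsEdgeGluing (4 * n) (orientableGluing n) := by
  rintro x y ⟨i, hi, t, ht, ⟨hx, hy⟩ | ⟨hx, hy⟩⟩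
  · exact ⟨4 * i, by omega, 4 * i + 2, by omega, t, ht, Or.inr ⟨Subtype.ext hx, Subtype.ext hy,
      fun s hs => ⟨i, hi, s, hs, Or.inl ⟨rfl, rfl⟩⟩⟩⟩
  · exact ⟨4 * i + 1, by omega, 4 * i + 3, by omega, t, ht, Or.inr ⟨Subtype.ext hx,
      Subtype.ext hy, fun s hs => ⟨i, hi, s, hs, Or.inr ⟨rfl, rfl⟩⟩⟩⟩

theorem isEdgeGluing_nonorientableGluing (k : ℕ) :
    IsEdgeGluing (2 * k) (nonorientableGluing k) := by
  rintro x y ⟨i, hi, t, ht, hx, hy⟩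
  exact ⟨2 * i, by omega, 2 * i + 1, by omega, t, ht, Or.inl ⟨Subtype.ext hx, Subtype.ext hy,
    fun s hs => ⟨i, hi, s, hs, rfl, rfl⟩⟩⟩

theorem IsClosedSurfaceOfGenus.half_le {S : Type*} [TopologicalSpace S] {g : ℝ}
    (hg : IsClosedSurfaceOfGenus S g) : 1 / 2 ≤ g := by
  obtain ⟨n, hn, -, rfl⟩ | ⟨k, hk, -, rfl⟩ := hg
  · have : (1 : ℝ) ≤ n := by exact_mod_cast hn
    linarith
  · have : (1 : ℝ) ≤ k := by exact_mod_cast hk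
    linarith

theorem IsClosedSurfaceOfGenus.cosh_le {g : ℝ} (hg : IsClosedSurfaceOfGenus (OrbitSpace G ℍ) g)
    {x : ℍ} (hr : 0 ≤ r)
    (hdisj : ∀ δ : G, δ ≠ 1 → Disjoint (δ • Metric.ball x r) (Metric.ball x r)) :
    Real.cosh r ≤ 2 * g := by
  rcases hr.eq_or_lt with rfl | hr
  · rw [Real.cosh_zero]
    linarith [hg.half_le]
  obtain ⟨n, hn, ⟨e⟩, rfl⟩ | ⟨k, hk, ⟨e⟩, rfl⟩ := hg
  · have := (isEdgeGluing_orientableGluing n).two_mul_cosh_le (by omega) e hr hdisj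
    push_cast at this
    linarith
  · have := (isEdgeGluing_nonorientableGluing k).two_mul_cosh_le (by omega) e hr hdisj
    push_cast at this
    linarith

end EmbeddedDisk

/-! ### Hyperbolic space -/

theorem exists_continuousMap_unitSquare {X V : Type*} [TopologicalSpace X] [AddCommGroup V]
    [Module ℝ V] [TopologicalSpace V] [IsTopologicalAddGroup V] [ContinuousSMul ℝ V] (h : X ≃ₜ V)
    {a b c d : X} (bottom : Path a b) (top : Path c d) (left : Path a c) (right : Path b d) :
    ∃ F : C(unitInterval × unitInterval, X), (∀ t, F (t, 0) = bottom t) ∧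
      (∀ t, F (t, 1) = top t) ∧ (∀ s, F (0, s) = left s) ∧ ∀ s, F (1, s) = right s := by
  -- Interpolate between opposite sides in both directions; the corners are then counted twice.
  let F : unitInterval × unitInterval → V := fun ts =>
    (1 - (ts.2 : ℝ)) • h (bottom ts.1) + (ts.2 : ℝ) • h (top ts.1)
      + (1 - (ts.1 : ℝ)) • h (left ts.2) + (ts.1 : ℝ) • h (right ts.2)
      - ((1 - (ts.1 : ℝ)) * (1 - ts.2)) • h a - (ts.1 * (1 - ts.2) : ℝ) • h b
      - ((1 - (ts.1 : ℝ)) * ts.2) • h c - (ts.1 * ts.2 : ℝ) • h d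
  have hF : Continuous F := by
    have := h.continuous
    fun_prop
  refine ⟨⟨fun ts => h.symm (F ts), h.symm.continuous.comp hF⟩, ?_, ?_, ?_, ?_⟩
  all_goals
    intro t
    simp only [ContinuousMap.coe_mk, Homeomorph.symm_apply_eq, F, Path.source, Path.target,
      Set.Icc.coe_zero, Set.Icc.coe_one]
    module

theorem sinh_half_abs_log_sub_log {a b : ℝ} (ha : 0 < a) (hb : 0 < b) :
    Real.sinh (|Real.log a - Real.log b| / 2) = |a - b| / (2 * √(a * b)) := by
  have hlog : (Real.log a - Real.log b) / 2 = Real.log (√a / √b) := by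
    rw [Real.log_div (by positivity) (by positivity), Real.log_sqrt ha.le, Real.log_sqrt hb.le]
    ring
  rw [← abs_two, ← abs_div, ← Real.abs_sinh, hlog, Real.sinh_log (by positivity), abs_two,
    ← abs_of_pos (show 0 < 2 * √(a * b) by positivity), ← abs_div, Real.sqrt_mul ha.le]
  congr 1
  field_simp
  rw [Real.sq_sqrt ha.le, Real.sq_sqrt hb.le]

namespace HypSpace

theorem abs_log_sub_log_le_dist (p q : HypSpace) :
    |Real.log p.z - Real.log q.z| ≤ dist p q := by
  have h : Real.sinh (|Real.log p.z - Real.log q.z| / 2) ≤ Real.sinh (dist p q / 2) := by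
    rw [sinh_half_abs_log_sub_log p.z_pos q.z_pos, sinh_half_dist, dist_toE]
    gcongr
    exact Real.abs_le_sqrt (le_add_of_nonneg_left (by positivity))
  linarith [Real.sinh_le_sinh.1 h]

theorem dist_eq_abs_log_sub_log {p q : HypSpace} (hx : p.x = q.x) (hy : p.y = q.y) :
    dist p q = |Real.log p.z - Real.log q.z| := by
  have h : Real.sinh (dist p q / 2) = Real.sinh (|Real.log p.z - Real.log q.z| / 2) := by
    simp [sinh_half_abs_log_sub_log p.z_pos q.z_pos, sinh_half_dist, dist_toE, hx, hy,
      Real.sqrt_sq_eq_abs]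
  linarith [Real.sinh_injective h]

theorem continuous_log_z : Continuous fun p : HypSpace => Real.log p.z :=
  (LipschitzWith.of_dist_le_mul (K := 1) fun p q => by
    simpa [Real.dist_eq] using abs_log_sub_log_le_dist p q).continuous

theorem continuous_z : Continuous z := by
  simpa only [Real.exp_log (z_pos _)] using continuous_log_z.rexp

theorem continuous_toE : Continuous toE := by
  refine continuous_iff_continuousAt.2 fun q => tendsto_iff_dist_tendsto_zero.2 ?_
  have hdist (p : HypSpace) :
      dist p.toE q.toE = 2 * √(p.z * q.z) * Real.sinh (dist p q / 2) := by
    have : 0 < p.z * q.z := mul_pos p.z_pos q.z_pos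
    rw [sinh_half_dist]
    field_simp
  have hcont : Continuous fun p : HypSpace => 2 * √(p.z * q.z) * Real.sinh (dist p q / 2) := by
    have := continuous_z
    fun_prop
  simpa [hdist] using hcont.tendsto q

theorem continuous_x : Continuous x := by
  simpa [Function.comp_def, toE] using
    (EuclideanSpace.proj (𝕜 := ℝ) (0 : Fin 3)).continuous.comp continuous_toE

theorem continuous_y : Continuous y := by
  simpa [Function.comp_def, toE] using
    (EuclideanSpace.proj (𝕜 := ℝ) (1 : Fin 3)).continuous.comp continuous_toE

/-- Hyperbolic space as a vector space, in the coordinates `(x, y, log z)`. -/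
def homeomorphProd : HypSpace ≃ₜ ℝ × ℝ × ℝ where
  toFun p := (p.x, p.y, Real.log p.z)
  invFun v := ⟨v.1, v.2.1, Real.exp v.2.2, Real.exp_pos _⟩
  left_inv p := by ext <;> simp [Real.exp_log p.z_pos]
  right_inv v := by simp
  continuous_toFun := continuous_x.prodMk (continuous_y.prodMk continuous_log_z)
  continuous_invFun := by
    refine continuous_iff_continuousAt.2 fun v => tendsto_iff_dist_tendsto_zero.2 ?_
    have hdist : Continuous fun u : ℝ × ℝ × ℝ =>
        dist (⟨u.1, u.2.1, Real.exp u.2.2, Real.exp_pos _⟩ : HypSpace)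
          ⟨v.1, v.2.1, Real.exp v.2.2, Real.exp_pos _⟩ := by
      simp only [dist_eq, dist_toE]
      exact continuous_const.mul (Real.continuous_arsinh.comp
        (Continuous.div (by fun_prop) (by fun_prop) fun u => by positivity))
    simpa using hdist.tendsto v

instance : LocallyCompactSpace HypSpace :=
  homeomorphProd.isClosedEmbedding.locallyCompactSpace

instance : ContractibleSpace HypSpace :=
  homeomorphProd.contractibleSpace_iff.2 inferInstance

end HypSpace

namespace HyperbolicPlane

open UpperHalfPlane

theorem exists_isGeodesicOn (a b : ℍ) : ∃ c : ℝ → ℍ, Continuous c ∧ c 0 = a ∧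
    c (dist a b) = b ∧ IsGeodesicOn c (Set.Icc 0 (dist a b)) := by
  obtain ⟨g, ha, hb, hb'⟩ := exists_smul_eq_I_and_re_smul_eq_zero a b
  have hc : Isometry fun y : ℝ => g⁻¹ • (mk ⟨0, Real.exp y⟩ (Real.exp_pos y) : ℍ) :=
    (isometry_smul ℍ g⁻¹).comp (isometry_vertical_line 0)
  have hd : dist a b = Real.log (g • b).im := by
    rw [← dist_smul g, ha, dist_of_re_eq (by rw [hb, I_re]), I_im, Real.log_one, dist_comm,
      dist_zero_right, Real.norm_of_nonneg (Real.log_nonneg hb')]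
  refine ⟨_, hc.continuous, ?_, ?_, fun s _ t _ => by rw [hc.dist_eq, Real.dist_eq]⟩
  · rw [inv_smul_eq_iff, ha]
    apply UpperHalfPlane.ext
    apply Complex.ext <;> simp
  · rw [inv_smul_eq_iff, hd]
    apply UpperHalfPlane.ext
    apply Complex.ext <;> simp [hb, Real.exp_log (g • b).im_pos]

end HyperbolicPlane

/-! ### Lifts and incompressibility -/

section NullHomotopic

variable {E F X Y : Type*} [TopologicalSpace E] [TopologicalSpace F] [TopologicalSpace X]
  [TopologicalSpace Y]

theorem homotopic_refl_of_lift [SimplyConnectedSpace E] {q : E → X} (hq : Continuous q) {x : X}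
    {l : Path x x} {L : C(unitInterval, E)} (hL : ∀ t, q (L t) = l t) (hclosed : L 0 = L 1) :
    l.Homotopic (Path.refl x) := by
  have hx : x = q (L 0) := by rw [hL, l.source]
  have hloop : (⟨L, rfl, hclosed.symm⟩ : Path (L 0) (L 0)).Homotopic (Path.refl _) :=
    SimplyConnectedSpace.paths_homotopic _ _
  convert (hloop.map ⟨q, hq⟩).pathCast hx hx using 1 <;> ext t
  · exact (hL t).symm
  · exact hx

theorem lift_zero_eq_lift_one_of_homotopic_refl {p : F → X} (hp : IsCoveringMap p) {x : X}
    {l : Path x x} {L : C(unitInterval, F)} (hL : ∀ t, p (L t) = l t)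
    (hl : l.Homotopic (Path.refl x)) : L 0 = L 1 := by
  have hx : x = p (L 0) := by rw [hL, l.source]
  have heq := hp.liftPath_apply_one_eq_of_homotopicRel hl (L 0) (l.source.trans hx) hx
  rw [← (hp.eq_liftPath_iff' _).2 ⟨funext hL, rfl⟩] at heq
  exact (heq.trans congr($(hp.liftPath_const hx) 1)).symm

theorem isIncompressible_iff {φ : C(X, Y)} : IsIncompressible φ ↔
    ∀ (x : X) (l : Path x x), (l.map φ.continuous).Homotopic (Path.refl (φ x)) →
      l.Homotopic (Path.refl x) := by
  simp only [IsIncompressible, injective_iff_map_eq_one]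
  refine forall_congr' fun x => ⟨fun h l hl => ?_, fun h a ha => ?_⟩
  · exact Path.Homotopic.Quotient.eq.1 (h (.fromPath (.mk l)) (Path.Homotopic.Quotient.eq.2 hl))
  · obtain ⟨l, rfl⟩ : ∃ l : Path x x, Path.Homotopic.Quotient.mk l = a :=
      Path.Homotopic.Quotient.mk_surjective a
    exact Path.Homotopic.Quotient.eq.2 (h l (Path.Homotopic.Quotient.eq.1 ha))

variable {q : E → X} {p : F → Y} {φ : C(X, Y)} {Φ : C(E, F)}

theorem IsIncompressible.eq_of_lift_eq [PathConnectedSpace E] [SimplyConnectedSpace F]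
    (hφ : IsIncompressible φ) (hq : IsCoveringMap q) (hp : Continuous p)
    (hΦ : ∀ e, p (Φ e) = φ (q e)) {e e' : E} (hqe : q e = q e') (hΦe : Φ e = Φ e') : e = e' := by
  let α := PathConnectedSpace.somePath e e'
  let l : Path (q e) (q e) := (α.map hq.continuous).cast rfl hqe
  have hl : l.Homotopic (Path.refl _) := isIncompressible_iff.1 hφ _ _ <|
    homotopic_refl_of_lift hp (L := Φ.comp α) (fun t => hΦ (α t)) (by simpa using hΦe)
  simpa using lift_zero_eq_lift_one_of_homotopic_refl hq (L := α) (fun t => rfl) hl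

theorem isIncompressible_of_lift_injective [SimplyConnectedSpace E] (hp : IsCoveringMap p)
    (hq : Continuous q) (hq_surj : Function.Surjective q)
    (hq_lift : ∀ (c : C(unitInterval, X)) (e : E), q e = c 0 →
      ∃ L : C(unitInterval, E), ∀ t, q (L t) = c t)
    (hΦ : ∀ e, p (Φ e) = φ (q e)) (hinj : ∀ e e', q e = q e' → Φ e = Φ e' → e = e') :
    IsIncompressible φ := by
  refine isIncompressible_iff.2 fun x l hl => ?_
  obtain ⟨e, rfl⟩ := hq_surj x
  obtain ⟨L, hL⟩ := hq_lift l e (by simp)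
  refine homotopic_refl_of_lift hq hL (hinj _ _ (by simp [hL]) ?_)
  exact lift_zero_eq_lift_one_of_homotopic_refl hp (L := Φ.comp L) (fun t => by simp [hΦ, hL]) hl

end NullHomotopic

namespace OrbitSpace

variable {G H X Y : Type*} [Group G] [MulAction G X] [Group H] [MulAction H Y]

/-- The map `F` lifts `f` to the spaces whose orbit spaces `f` relates. -/
def IsLift [TopologicalSpace X] [TopologicalSpace Y] (F : C(X, Y))
    (f : C(OrbitSpace G X, OrbitSpace H Y)) : Prop :=
  ∀ x, proj H (F x) = f (proj G x)

section Lift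

variable [TopologicalSpace X] [TopologicalSpace Y] [ContinuousConstSMul H Y]
  [ProperlyDiscontinuousSMul H Y] [LocallyCompactSpace Y] [T2Space Y] [IsCancelSMul H Y]
  {F : C(X, Y)} {f : C(OrbitSpace G X, OrbitSpace H Y)}

theorem exists_isLift [SimplyConnectedSpace X] [LocallyPathConnectedSpace X] {x : X} {y : Y}
    (h : proj H y = f (proj G x)) : ∃ F : C(X, Y), F x = y ∧ IsLift F f := by
  obtain ⟨F, ⟨hFx, hF⟩, -⟩ := (isCoveringMap_proj (G := H)).existsUnique_continuousMap_lifts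
    (f.comp ⟨_, continuous_proj⟩) x y h
  exact ⟨F, hFx, congrFun hF⟩

theorem IsLift.exists_apply_smul_eq [ConnectedSpace X] [ContinuousConstSMul G X]
    (hF : IsLift F f) (g : G) : ∃ h : H, ∀ x, F (g • x) = h • F x := by
  have hproj (x : X) : proj H (F (g • x)) = proj H (F x) := by
    rw [hF, hF, proj_smul]
  obtain ⟨x₀⟩ : Nonempty X := inferInstance
  obtain ⟨h, hh⟩ := proj_eq_proj_iff.1 (hproj x₀)
  exact ⟨h, eq_smul_of_proj_comp_eq F.continuous (F.continuous.comp (continuous_const_smul g))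
    hproj hh.symm⟩

end Lift

/-- A map of hyperbolic manifolds (or of other orbit spaces) none of whose lifts increases
distances, and which therefore does not increase the lengths of paths. -/
def IsNonexpanding [PseudoMetricSpace X] [PseudoMetricSpace Y]
    (f : C(OrbitSpace G X, OrbitSpace H Y)) : Prop :=
  ∀ F : C(X, Y), IsLift F f → LipschitzWith 1 F

end OrbitSpace

section Pleated

variable {Γ Δ : Type*} [Group Γ] [MulAction Γ HypSpace] [IsIsometricSMul Γ HypSpace]
  [ProperlyDiscontinuousSMul Γ HypSpace] [IsCancelSMul Γ HypSpace] [Group Δ] [MulAction Δ ℍ]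

theorem IsPleatedSurface.isNonexpanding {φ : C(OrbitSpace Δ ℍ, OrbitSpace Γ HypSpace)}
    (hφ : IsPleatedSurface φ) : OrbitSpace.IsNonexpanding φ := fun Φ hΦ =>
  LipschitzWith.of_edist_le fun a b => by
  obtain ⟨c, hc, rfl, hcb, hgeo⟩ := HyperbolicPlane.exists_isGeodesicOn a b
  set l := dist (c 0) b
  obtain ⟨c', hc', ⟨hcont, -⟩, hvar⟩ := hφ.isometric l c dist_nonneg hgeo
  have h0 : (0 : ℝ) ∈ Set.Icc 0 l := ⟨le_rfl, dist_nonneg⟩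
  have h1 : l ∈ Set.Icc 0 l := ⟨dist_nonneg, le_rfl⟩
  have : PreconnectedSpace (Set.Icc 0 l) :=
    isPreconnected_iff_preconnectedSpace.1 isPreconnected_Icc
  obtain ⟨γ, hγ⟩ := OrbitSpace.proj_eq_proj_iff.1 ((hc' 0 h0).trans (hΦ (c 0)).symm)
  have c'_eq : ∀ t : Set.Icc 0 l, c' t = γ • Φ (c t) :=
    OrbitSpace.eq_smul_of_proj_comp_eq (a := fun t : Set.Icc 0 l => Φ (c t)) (b := fun t => c' t)
      (by fun_prop) hcont.domRestrict (fun t => by rw [hc' t t.2, hΦ]) (y₀ := ⟨0, h0⟩) hγ.symm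
  calc edist (Φ (c 0)) (Φ b) = edist (c' 0) (c' l) := by
        rw [c'_eq ⟨0, h0⟩, c'_eq ⟨l, h1⟩, hcb, edist_smul_left]
    _ ≤ eVariationOn c' (Set.Icc 0 l) := eVariationOn.edist_le c' h0 h1
    _ = edist (c 0) b := by rw [hvar, edist_dist]

end Pleated

/-! ### Incompressible annuli -/

section Circle

/-- The parametrization of the circle by the unit interval, with the end points identified. -/
def circleParam : C(unitInterval, Circle) where
  toFun t := Circle.exp (2 * Real.pi * t)

theorem circleParam_surjective : Function.Surjective circleParam := fun u => by
  obtain ⟨θ, rfl⟩ : ∃ θ, Circle.exp θ = u := ⟨_, Circle.exp_arg u⟩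
  obtain ⟨y, hy, hθ⟩ := Circle.periodic_exp.exists_mem_Ico₀ Real.two_pi_pos θ
  refine ⟨⟨y / (2 * Real.pi), ?_, ?_⟩, ?_⟩
  · exact div_nonneg hy.1 Real.two_pi_pos.le
  · exact (div_le_one Real.two_pi_pos).2 hy.2.le
  · rw [hθ, circleParam, ContinuousMap.coe_mk, mul_div_cancel₀ _ Real.two_pi_pos.ne']

theorem eq_or_of_circleParam_eq {s t : unitInterval} (h : circleParam s = circleParam t) :
    s = t ∨ s = 0 ∧ t = 1 ∨ s = 1 ∧ t = 0 := by
  obtain ⟨n, hn⟩ := Circle.exp_eq_exp.1 h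
  have hst : (s : ℝ) = t + n := mul_left_cancel₀ Real.two_pi_pos.ne' (by rw [hn]; ring)
  have hn_lower : -1 ≤ n := by exact_mod_cast (by linarith [s.2.1, t.2.2] : (-1 : ℝ) ≤ n)
  have hn_upper : n ≤ 1 := by exact_mod_cast (by linarith [s.2.2, t.2.1] : (n : ℝ) ≤ 1)
  simp only [Subtype.ext_iff, Set.Icc.coe_zero, Set.Icc.coe_one]
  interval_cases n <;> push_cast at hst
  · exact .inr (.inl ⟨by linarith [s.2.1, t.2.2], by linarith [s.2.1, t.2.2]⟩)
  · exact .inl (by linarith)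
  · exact .inr (.inr ⟨by linarith [s.2.2, t.2.1], by linarith [s.2.2, t.2.1]⟩)

theorem exists_circle_map {Y : Type*} [TopologicalSpace Y] (f : C(unitInterval, Y))
    (h : f 0 = f 1) : ∃ a : C(Circle, Y), ∀ t, a (circleParam t) = f t := by
  have hquot : Topology.IsQuotientMap circleParam :=
    circleParam.continuous.isClosedMap.isQuotientMap circleParam.continuous circleParam_surjective
  have hf : Function.FactorsThrough f circleParam := fun s t hst => by
    rcases eq_or_of_circleParam_eq hst with rfl | ⟨rfl, rfl⟩ | ⟨rfl, rfl⟩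
    exacts [rfl, h, h.symm]
  exact ⟨hquot.lift f hf, fun t => congr($(hquot.lift_comp f hf) t)⟩

end Circle

theorem apply_add_zsmul_eq_zpow_smul {A G X : Type*} [AddGroup A] [Group G] [MulAction G X]
    {f : A → X} {a : A} {g : G} (h : ∀ x, f (x + a) = g • f x) (n : ℤ) (x : A) :
    f (x + n • a) = g ^ n • f x := by
  induction n using Int.induction_on with
  | zero => simp
  | succ n ih => rw [add_zsmul, one_zsmul, ← add_assoc, h, ih, smul_smul, add_comm, zpow_one_add]
  | pred n ih =>
    rw [← sub_add_cancel (-n : ℤ) 1, add_zsmul, one_zsmul, ← add_assoc, h] at ih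
    rw [← smul_left_cancel_iff g, ih, smul_smul, ← zpow_one_add, add_comm 1]

/-- The universal covering of the annulus. -/
def annulusCover : C(ℝ × unitInterval, Circle × unitInterval) where
  toFun v := (Circle.exp v.1, v.2)

theorem exists_annulusCover_lift {c : C(unitInterval, Circle × unitInterval)}
    {v : ℝ × unitInterval} (hv : annulusCover v = c 0) :
    ∃ L : C(unitInterval, ℝ × unitInterval), ∀ t, annulusCover (L t) = c t := by
  obtain ⟨θ, hθ, -⟩ := Circle.isCoveringMap_exp.exists_path_lifts
    (ContinuousMap.fst.comp c) v.1 congr(($hv).1).symm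
  exact ⟨θ.prodMk (ContinuousMap.snd.comp c), fun t => Prod.ext congr($hθ t) rfl⟩

instance : LocallyPathConnectedSpace unitInterval :=
  (convex_Icc 0 1).locallyPathConnectedSpace

instance : ContractibleSpace unitInterval :=
  (convex_Icc (0 : ℝ) 1).contractibleSpace ⟨0, unitInterval.zero_mem⟩

section Annulus

variable {G X : Type*} [Group G] [MulAction G X] [TopologicalSpace X] [ContinuousConstSMul G X]
  [ProperlyDiscontinuousSMul G X] [LocallyCompactSpace X] [T2Space X] [IsCancelSMul G X] {g : G}

theorem isIncompressible_of_lift_add_two_pi {A : C(Circle × unitInterval, OrbitSpace G X)}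
    {L : C(ℝ × unitInterval, X)} (hL : ∀ v, OrbitSpace.proj G (L v) = A (annulusCover v))
    (hLg : ∀ θ s, L (θ + 2 * Real.pi, s) = g • L (θ, s)) (hg : ¬IsOfFinOrder g) :
    IsIncompressible A := by
  refine isIncompressible_of_lift_injective OrbitSpace.isCoveringMap_proj annulusCover.continuous
    (Circle.exp_surjective.prodMap Function.surjective_id)
    (fun c v hv => exists_annulusCover_lift hv) hL ?_
  rintro ⟨θ, s⟩ ⟨θ', s'⟩ hθs hLeq
  obtain rfl : s = s' := congr(($hθs).2)
  have hθ : Circle.exp θ = Circle.exp θ' := congr(($hθs).1)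
  obtain ⟨n, rfl⟩ := Circle.exp_eq_exp.1 hθ
  rw [← zsmul_eq_mul, apply_add_zsmul_eq_zpow_smul (f := fun θ => L (θ, s)) (hLg · s)] at hLeq
  have hn : g ^ n = g ^ (0 : ℤ) :=
    IsCancelSMul.right_cancel _ _ _ (by rw [hLeq, zpow_zero, one_smul])
  rw [injective_zpow_iff_not_isOfFinOrder.2 hg hn, Int.cast_zero, zero_mul, add_zero]

theorem exists_isIncompressible_annulus (hg : ¬IsOfFinOrder g)
    (strip : C(unitInterval × unitInterval, X)) (hstrip : ∀ s, strip (1, s) = g • strip (0, s)) :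
    ∃ A : C(Circle × unitInterval, OrbitSpace G X), IsIncompressible A ∧
      ∀ t s, A (circleParam t, s) = OrbitSpace.proj G (strip (t, s)) := by
  let P : C(X, OrbitSpace G X) := ⟨_, OrbitSpace.continuous_proj⟩
  obtain ⟨A, hA⟩ := exists_circle_map (P.comp strip).curry <| ContinuousMap.ext fun s =>
    ((congrArg (OrbitSpace.proj G) (hstrip s)).trans (OrbitSpace.proj_smul g _)).symm
  replace hA (t s) : A.uncurry (circleParam t, s) = OrbitSpace.proj G (strip (t, s)) :=
    congr($(hA t) s)
  refine ⟨A.uncurry, ?_, hA⟩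
  obtain ⟨L, ⟨hL0, hL⟩, -⟩ := (OrbitSpace.isCoveringMap_proj (G := G)
    (X := X)).existsUnique_continuousMap_lifts (A.uncurry.comp annulusCover) (0, 0) (strip (0, 0))
      (by rw [← hA]; simp [annulusCover, circleParam])
  replace hL (v) : OrbitSpace.proj G (L v) = A.uncurry (annulusCover v) := congrFun hL v
  have L_eq_strip (t s : unitInterval) : L (2 * Real.pi * t, s) = strip (t, s) := by
    have := OrbitSpace.eq_smul_of_proj_comp_eq (G := G) (a := strip)
      (b := fun v => L (2 * Real.pi * v.1, v.2)) (by fun_prop) (by fun_prop)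
      (fun v => by rw [hL, ← hA]; rfl) (g := 1) (y₀ := (0, 0)) (by simp [hL0]) (t, s)
    simpa using this
  refine isIncompressible_of_lift_add_two_pi hL (fun θ s => ?_) hg
  exact OrbitSpace.eq_smul_of_proj_comp_eq (G := G) (a := L)
    (b := fun v => L (v.1 + 2 * Real.pi, v.2)) (by fun_prop) (by fun_prop)
    (fun v => by simp [hL, annulusCover, Circle.exp_add]) (y₀ := (0, 0))
    (by simpa [hstrip, hL0] using L_eq_strip 1 0) (θ, s)

end Annulus

/-! ### Isometries preserving a horoball -/

theorem exists_fixedPoint_of_isometry_iterate_eq {E : Type*} [NormedAddCommGroup E]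
    [NormedSpace ℝ E] {f : E → E} (hf : Isometry f) {n : ℕ} (hn : n ≠ 0)
    (hfn : ∀ v, f^[n] v = v) : ∃ c, f c = c := by
  have hright (v : E) : f (f^[n - 1] v) = v := by
    rw [← Function.iterate_succ_apply' f, Nat.succ_eq_add_one,
      Nat.sub_add_cancel (Nat.pos_of_ne_zero hn), hfn]
  -- By the Mazur–Ulam theorem `f` is affine, so it fixes the centroid of the orbit of `0`.
  let F := (IsometryEquiv.mk' f _ hright hf).toRealAffineIsometryEquiv.toAffineEquiv.toAffineMap
  have hcentroid (p : ℕ → E) : f ((Finset.range n).centroid ℝ p) =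
      (Finset.range n).centroid ℝ (f ∘ p) :=
    (Finset.range n).map_affineCombination p _
      (Finset.sum_centroidWeights_eq_one_of_card_ne_zero ℝ _ (by simpa)) F
  refine ⟨(Finset.range n).centroid ℝ (f^[·] 0), ?_⟩
  have hsum : ∑ k ∈ Finset.range n, f^[k + 1] 0 = ∑ k ∈ Finset.range n, f^[k] 0 := by
    have := Finset.sum_range_succ (f^[·] (0 : E)) n
    rwa [Finset.sum_range_succ', hfn, Function.iterate_zero_apply, add_left_inj] at this
  rw [hcentroid, Finset.centroid_def, Finset.centroid_def,
    Finset.affineCombination_eq_linear_combination, Finset.affineCombination_eq_linear_combination]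
  · simp only [Finset.centroidWeights_apply, ← Finset.smul_sum, Function.comp_apply,
      ← Function.iterate_succ_apply' f, hsum]
  all_goals exact Finset.sum_centroidWeights_eq_one_of_card_ne_zero ℝ _ (by simpa)

namespace HypSpace

/-- The horosphere of height one, parametrized by the complex plane. -/
def ofComplex (w : ℂ) : HypSpace := ⟨w.re, w.im, 1, one_pos⟩

theorem ofComplex_mk {p : HypSpace} (hp : p.z = 1) : ofComplex ⟨p.x, p.y⟩ = p :=
  HypSpace.ext rfl rfl hp.symm

theorem ofComplex_injective : Function.Injective ofComplex := fun _ _ h =>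
  Complex.ext congr(($h).x) congr(($h).y)

theorem dist_ofComplex (v w : ℂ) :
    dist (ofComplex v) (ofComplex w) = 2 * Real.arsinh (dist v w / 2) := by
  simp [dist_eq, dist_toE, Complex.dist_eq_re_im, ofComplex]

theorem continuous_ofComplex : Continuous ofComplex := by
  refine continuous_iff_continuousAt.2 fun v => tendsto_iff_dist_tendsto_zero.2 ?_
  have : Continuous fun w : ℂ => 2 * Real.arsinh (dist w v / 2) :=
    continuous_const.mul (Real.continuous_arsinh.comp (by fun_prop))
  simpa [dist_ofComplex] using this.tendsto v

theorem z_eq_one_of_image_eq {h : HypSpace ≃ᵢ HypSpace}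
    (hh : h '' {p | 1 ≤ p.z} = {p | 1 ≤ p.z}) {p : HypSpace} (hp : p.z = 1) : (h p).z = 1 := by
  have hmem (q : HypSpace) : 1 ≤ (h q).z ↔ 1 ≤ q.z := by
    rw [← Set.mem_ofPred_eq (p := fun p : HypSpace => 1 ≤ p.z), ← hh, h.injective.mem_set_image]
    rfl
  refine (((hmem p).2 hp.ge).eq_of_not_lt fun hlt => ?_).symm
  -- Otherwise the point below `p` at distance `log (h p).z` is mapped to a point above height `1`.
  have hlog : 0 < Real.log (h p).z := Real.log_pos hlt
  let q : HypSpace := ⟨p.x, p.y, Real.exp (-Real.log (h p).z), Real.exp_pos _⟩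
  have hpq : dist (h p) (h q) = Real.log (h p).z := by
    rw [h.dist_eq, dist_eq_abs_log_sub_log (p := p) (q := q) rfl rfl, hp]
    simp [q, hlog.le]
  have hq : 1 ≤ (h q).z := by
    rw [← Real.log_nonneg_iff (h q).z_pos]
    linarith [le_abs_self (Real.log (h p).z - Real.log (h q).z),
      abs_log_sub_log_le_dist (h p) (h q)]
  have : q.z < 1 := Real.exp_lt_one_iff.2 (neg_neg_of_pos hlog)
  exact this.not_ge ((hmem q).1 hq)

theorem exists_isometry_of_image_eq {h : HypSpace ≃ᵢ HypSpace}
    (hh : h '' {p | 1 ≤ p.z} = {p | 1 ≤ p.z}) :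
    ∃ f : ℂ → ℂ, Isometry f ∧ ∀ w, ofComplex (f w) = h (ofComplex w) := by
  choose f hf using fun w => (⟨_, ofComplex_mk (z_eq_one_of_image_eq hh rfl)⟩ :
    ∃ v, ofComplex v = h (ofComplex w))
  refine ⟨f, Isometry.of_dist_eq fun v w => ?_, hf⟩
  have hdist := h.dist_eq (ofComplex v) (ofComplex w)
  rw [← hf, ← hf, dist_ofComplex, dist_ofComplex] at hdist
  linarith [Real.arsinh_injective (mul_left_cancel₀ two_ne_zero hdist)]

end HypSpace

namespace ToroidalCusp

variable {Γ : Type*} [Group Γ] [MulAction Γ HypSpace] {N : ToroidalCusp Γ} {γ : Γ}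

/-- The parametrization by the complex plane of the horosphere bounding the horoball. -/
def horospherePoint (N : ToroidalCusp Γ) (w : ℂ) : HypSpace := N.chart (HypSpace.ofComplex w)

theorem horospherePoint_injective (N : ToroidalCusp Γ) : Function.Injective N.horospherePoint :=
  N.chart.injective.comp HypSpace.ofComplex_injective

theorem continuous_horospherePoint (N : ToroidalCusp Γ) : Continuous N.horospherePoint :=
  N.chart.continuous.comp HypSpace.continuous_ofComplex

variable [IsIsometricSMul Γ HypSpace]

theorem exists_isometry_horospherePoint_eq (hγ : γ • N.horoball = N.horoball) :
    ∃ f : ℂ → ℂ, Isometry f ∧ ∀ w, N.horospherePoint (f w) = γ • N.horospherePoint w := by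
  let h := (N.chart.trans (IsometryEquiv.constSMul γ)).trans N.chart.symm
  have hh : h '' {p | 1 ≤ p.z} = {p | 1 ≤ p.z} := by
    rw [← N.chart.injective.image_injective.eq_iff, Set.image_image]
    simpa [h, horoball, ← Set.image_smul, Set.image_image] using hγ
  obtain ⟨f, hf, hfh⟩ := HypSpace.exists_isometry_of_image_eq hh
  exact ⟨f, hf, fun w => by simp [horospherePoint, hfh, h]⟩

theorem not_isOfFinOrder_of_smul_horoball_eq [IsCancelSMul Γ HypSpace]
    (hγ : γ • N.horoball = N.horoball) (h1 : γ ≠ 1) : ¬IsOfFinOrder γ := fun hfin => by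
  obtain ⟨n, hn, hγn⟩ := isOfFinOrder_iff_pow_eq_one.1 hfin
  obtain ⟨f, hf, hfγ⟩ := exists_isometry_horospherePoint_eq hγ
  have hiterate (w : ℂ) : f^[n] w = w := N.horospherePoint_injective <| by
    rw [Function.Semiconj.iterate_right (f := N.horospherePoint) hfγ n w, smul_iterate_apply, hγn,
      one_smul]
  obtain ⟨c, hc⟩ := exists_fixedPoint_of_isometry_iterate_eq hf hn.ne' hiterate
  exact h1 (IsCancelSMul.right_cancel _ _ _ (by rw [← hfγ, hc, one_smul]))

end ToroidalCusp

/-! ### Coannular surfaces -/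

namespace ToroidalCusp

variable {Γ : Type*} [Group Γ] [MulAction Γ HypSpace] {N : ToroidalCusp Γ} {γ : Γ}

theorem exists_torus_loop (hγ : γ • N.horoball = N.horoball) (σ : C(unitInterval, ℂ))
    (hσ : N.horospherePoint (σ 1) = γ • N.horospherePoint (σ 0)) : ∃ b : C(Circle, N.Torus),
      ∀ t, N.torusMap (b (circleParam t)) = OrbitSpace.proj Γ (N.horospherePoint (σ t)) := by
  let τ : C(unitInterval, N.horosphere) :=
    ⟨fun t => ⟨N.horospherePoint (σ t), _, rfl, rfl⟩,
      (N.continuous_horospherePoint.comp σ.continuous).subtype_mk _⟩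
  obtain ⟨b, hb⟩ := exists_circle_map (⟨Quot.mk _ ∘ τ, continuous_quot_mk.comp τ.continuous⟩ :
    C(unitInterval, N.Torus)) (Quot.sound ⟨γ, hγ, hσ.symm⟩)
  exact ⟨b, fun t => congrArg N.torusMap (hb t)⟩

variable [IsIsometricSMul Γ HypSpace] [ProperlyDiscontinuousSMul Γ HypSpace]
  [IsCancelSMul Γ HypSpace]

theorem coannular_of_isLift {Δ X : Type*} [Group Δ] [MulAction Δ X] [TopologicalSpace X]
    [PathConnectedSpace X] {φ : C(OrbitSpace Δ X, OrbitSpace Γ HypSpace)} {Φ : C(X, HypSpace)}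
    (hΦ : OrbitSpace.IsLift Φ φ) {δ : Δ} (hδ : ∀ x, Φ (δ • x) = γ • Φ x)
    (hγ : γ • N.horoball = N.horoball) (h1 : γ ≠ 1) : N.Coannular φ := by
  obtain ⟨x⟩ : Nonempty X := inferInstance
  obtain ⟨f, -, hf⟩ := exists_isometry_horospherePoint_eq hγ
  let α : Path x (δ • x) := PathConnectedSpace.somePath _ _
  let σ : Path 0 (f 0) := PathConnectedSpace.somePath _ _
  let side : Path (Φ x) (N.horospherePoint 0) := PathConnectedSpace.somePath _ _
  obtain ⟨strip, hbottom, htop, hleft, hright⟩ := exists_continuousMap_unitSquare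
    HypSpace.homeomorphProd ((α.map Φ.continuous).cast rfl (hδ x).symm)
    ((σ.map N.continuous_horospherePoint).cast rfl (hf 0).symm) side
    (side.map (continuous_const_smul γ))
  obtain ⟨A, hA, hAstrip⟩ := exists_isIncompressible_annulus
    (not_isOfFinOrder_of_smul_horoball_eq hγ h1) strip fun s => by
      rw [hright, hleft, Path.map_coe, Function.comp_apply]
  obtain ⟨a, ha⟩ := exists_circle_map
    (⟨OrbitSpace.proj Δ ∘ α, OrbitSpace.continuous_proj.comp α.continuous⟩ : C(unitInterval, _))
    (by simp [OrbitSpace.proj_smul])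
  obtain ⟨b, hb⟩ := exists_torus_loop hγ σ.toContinuousMap (by simpa using hf 0)
  refine ⟨A, a, b, hA, circleParam_surjective.forall.2 fun t => ?_,
    circleParam_surjective.forall.2 fun t => ?_⟩
  · rw [hAstrip, hbottom, ha]
    exact hΦ (α t)
  · rw [hAstrip, htop, hb]
    rfl

end ToroidalCusp

/-! ### The depth of a surface -/

theorem OrbitSpace.qdist_proj_le {G X : Type*} [Group G] [MulAction G X] [PseudoEMetricSpace X]
    (x y : X) : OrbitSpace.qdist (OrbitSpace.proj G x) (OrbitSpace.proj G y) ≤ edist x y :=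
  iInf₂_le_of_le x rfl (iInf₂_le_of_le y rfl le_rfl)

namespace ToroidalCusp

variable {Γ : Type*} [Group Γ] [MulAction Γ HypSpace] {N : ToroidalCusp Γ} {p q : HypSpace}

/-- The Euclidean height of a point in the upper half-space in which the horoball is `{z ≥ 1}`;
its logarithm is the signed distance to the horosphere. -/
def height (N : ToroidalCusp Γ) (p : HypSpace) : ℝ := (N.chart.symm p).z

theorem height_pos (N : ToroidalCusp Γ) (p : HypSpace) : 0 < N.height p :=
  (N.chart.symm p).z_pos

theorem mem_horoball_iff : p ∈ N.horoball ↔ 1 ≤ N.height p :=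
  Set.mem_image_equiv (f := N.chart.toEquiv)

theorem log_height_sub_log_height_le (N : ToroidalCusp Γ) (p q : HypSpace) :
    Real.log (N.height p) - Real.log (N.height q) ≤ dist p q :=
  (le_abs_self _).trans <|
    (HypSpace.abs_log_sub_log_le_dist _ _).trans_eq (N.chart.symm.dist_eq p q)

theorem smul_horoball_eq {γ : Γ} (hp : 1 < N.height p) (hγp : 1 < N.height (γ • p)) :
    γ • N.horoball = N.horoball := by
  have mem_interior {q : HypSpace} (hq : 1 < N.height q) : q ∈ N.chart '' {p | 1 < p.z} :=
    ⟨N.chart.symm q, hq, N.chart.apply_symm_apply q⟩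
  exact (N.precisely_invariant γ).resolve_right <|
    Set.Nonempty.not_disjoint ⟨γ • p, Set.smul_mem_smul_set (mem_interior hp), mem_interior hγp⟩

theorem iInf_qdist_le (hp : 1 ≤ N.height p) :
    ⨅ t : N.Torus, OrbitSpace.qdist (OrbitSpace.proj Γ p) (N.torusMap t) ≤
      ENNReal.ofReal (Real.log (N.height p)) := by
  let foot : HypSpace := ⟨(N.chart.symm p).x, (N.chart.symm p).y, 1, one_pos⟩
  have hdist : edist p (N.chart foot) = ENNReal.ofReal (Real.log (N.height p)) := by
    rw [← N.chart.symm.edist_eq, N.chart.symm_apply_apply, edist_dist,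
      HypSpace.dist_eq_abs_log_sub_log (p := N.chart.symm p) (q := foot) rfl rfl,
      Real.log_one, sub_zero]
    exact congrArg _ (abs_of_nonneg (Real.log_nonneg hp))
  exact iInf_le_of_le (Quot.mk _ ⟨N.chart foot, foot, rfl, rfl⟩) <|
    (OrbitSpace.qdist_proj_le _ _).trans hdist.le

end ToroidalCusp

theorem IsClosedSurfaceOfGenus.ofReal_arcosh_lt_ofReal_log {S : Type*} [TopologicalSpace S] {g : ℝ}
    (hg : IsClosedSurfaceOfGenus S g) :
    ENNReal.ofReal (Real.arcosh (2 * g)) < ENNReal.ofReal (Real.log (2 * g * Real.pi)) := by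
  have hg' : 1 ≤ 2 * g := by linarith [hg.half_le]
  have hlt : Real.arcosh (2 * g) < Real.log (2 * g * Real.pi) := by
    rw [Real.lt_log_iff_exp_lt (by positivity), Real.exp_arcosh hg']
    have : √((2 * g) ^ 2 - 1) ≤ 2 * g := Real.sqrt_le_iff.2 ⟨by linarith, by linarith⟩
    nlinarith [Real.pi_gt_three]
  exact (ENNReal.ofReal_lt_ofReal_iff_of_nonneg (Real.arcosh_nonneg hg')).2 hlt

section Depth

variable {Γ : Type*} [Group Γ] [MulAction Γ HypSpace] [IsIsometricSMul Γ HypSpace]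
  [ProperlyDiscontinuousSMul Γ HypSpace] [IsCancelSMul Γ HypSpace]
  {Δ : Type*} [Group Δ] [MulAction Δ ℍ] [IsIsometricSMul Δ ℍ] [ProperlyDiscontinuousSMul Δ ℍ]
  [IsCancelSMul Δ ℍ]

theorem ToroidalCusp.disjoint_smul_ball (N : ToroidalCusp Γ)
    {φ : C(OrbitSpace Δ ℍ, OrbitSpace Γ HypSpace)} (hφ : OrbitSpace.IsNonexpanding φ)
    (hinc : IsIncompressible φ) (hcoann : ¬N.Coannular φ) {x : ℍ} {p : HypSpace}
    (hpx : OrbitSpace.proj Γ p = φ (OrbitSpace.proj Δ x)) {δ : Δ} (hδ : δ ≠ 1) :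
    Disjoint (δ • Metric.ball x (Real.log (N.height p)))
      (Metric.ball x (Real.log (N.height p))) := by
  obtain ⟨Φ, rfl, hΦ⟩ := OrbitSpace.exists_isLift hpx
  obtain ⟨γ, hγ⟩ := hΦ.exists_apply_smul_eq δ
  have one_lt_height {u : ℍ} (hu : u ∈ Metric.ball x (Real.log (N.height (Φ x)))) :
      1 < N.height (Φ u) := by
    rw [← Real.log_pos_iff (N.height_pos _).le]
    have hdist := (hφ Φ hΦ).dist_le_mul x u
    rw [NNReal.coe_one, one_mul] at hdist
    linarith [Metric.mem_ball'.1 hu, N.log_height_sub_log_height_le (Φ x) (Φ u)]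
  have hγ1 : γ ≠ 1 := by
    rintro rfl
    have hfix : δ • x = x := hinc.eq_of_lift_eq OrbitSpace.isCoveringMap_proj
      OrbitSpace.continuous_proj hΦ (OrbitSpace.proj_smul δ x) (by rw [hγ, one_smul])
    exact hδ (IsCancelSMul.right_cancel _ _ x (by rw [hfix, one_smul]))
  refine Set.disjoint_left.2 fun _ hv hv' => hcoann ?_
  obtain ⟨u, hu, rfl⟩ := Set.mem_smul_set.1 hv
  exact coannular_of_isLift hΦ hγ
    (smul_horoball_eq (one_lt_height hu) (hγ u ▸ one_lt_height hv')) hγ1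

theorem theorem1p1_general (N : ToroidalCusp Γ) (φ : C(OrbitSpace Δ ℍ, OrbitSpace Γ HypSpace))
    (hφ : OrbitSpace.IsNonexpanding φ) (g : ℝ) (hg : IsClosedSurfaceOfGenus (OrbitSpace Δ ℍ) g)
    (hinc : IsIncompressible φ) (hcoann : ¬N.Coannular φ) :
    N.depth φ ≤ ENNReal.ofReal (Real.arcosh (2 * g)) := by
  refine iSup₂_le fun s hs => ?_
  obtain ⟨p, hp, hps⟩ := hs
  obtain ⟨x, rfl⟩ := OrbitSpace.proj_surjective s
  have hheight : 1 ≤ N.height p := ToroidalCusp.mem_horoball_iff.1 hp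
  have hlog : 0 ≤ Real.log (N.height p) := Real.log_nonneg hheight
  have hcosh : Real.cosh (Real.log (N.height p)) ≤ 2 * g :=
    hg.cosh_le hlog fun _ hδ => N.disjoint_smul_ball hφ hinc hcoann hps hδ
  rw [← hps]
  refine (ToroidalCusp.iInf_qdist_le hheight).trans (ENNReal.ofReal_le_ofReal ?_)
  rw [← Real.arcosh_cosh hlog]
  exact (Real.arcosh_le_arcosh (Real.cosh_pos _) ((Real.cosh_pos _).trans_le hcosh)).2 hcosh

end Depth

end

theorem theorem1p1
    {Γ : Type*} [Group Γ] [MulAction Γ HypSpace] [IsIsometricSMul Γ HypSpace]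
    [ProperlyDiscontinuousSMul Γ HypSpace] [IsCancelSMul Γ HypSpace]
    {Δ : Type*} [Group Δ] [MulAction Δ UpperHalfPlane] [IsIsometricSMul Δ UpperHalfPlane]
    [ProperlyDiscontinuousSMul Δ UpperHalfPlane] [IsCancelSMul Δ UpperHalfPlane]
    (N : ToroidalCusp Γ)
    (φ : C(OrbitSpace Δ UpperHalfPlane, OrbitSpace Γ HypSpace))
    (hφ : IsPleatedSurface φ)
    (g : ℝ) (hg : IsClosedSurfaceOfGenus (OrbitSpace Δ UpperHalfPlane) g)
    (hinc : IsIncompressible φ)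
    (hcoann : ¬ N.Coannular φ) :
    N.depth φ < ENNReal.ofReal (Real.log (2 * g * Real.pi)) :=
  (theorem1p1_general N φ hφ.isNonexpanding g hg hinc hcoann).trans_lt
    hg.ofReal_arcosh_lt_ofReal_log
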